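/- **Definitions.** An infinite real matrix is *totally positive* (TP) if all its minors are nonnegative; a matrix over a polynomial ring $\mathbb R[\mathbf x]$ is $\mathbf x$-TP if all its minors are polynomials with nonnegative coefficients. A formal power series $\sum_n a_nt^n\in\mathbb R[[t]]$ is *PF* if its Toeplitz matrix $[a_{i-j}]_{i,j\ge0}$ (with $a_n=0$ for $n<0$) is TP. A real sequence $(a_n)_{n\ge0}$ is *Stieltjes moment* (SM) if $a_n=\int_0^\infty x^n\,d\mu(x)$ for all $n\ge 0$ for some nonnegative measure $\mu$ on $[0,\infty)$; a sequence in $\mathbb R[\mathbf x]$ is $\mathbf x$-SM if its Hankel matrix $[a_{i+j}]_{i,j\ge0}$ is $\mathbf x$-TP. With $\mathcal L[a_i]=a_{i-1}a_{i+1}-a_i^2$ $(i\ge1)$, a sequence is *$3$-$\mathbf x$-log-convex* if all terms $\mathcal L^m[a_i]$ $(i\ge m)$, $0\le m\le 3$, have nonnegative coefficients (*$3$-log-convex*, for a real sequence, if they are nonnegative). For a lower triangular real matrix $A=[a_{n,k}]$, the *$A$-convolution* $z_n=\sum_{k=0}^n a_{n,k}x_ky_{n-k}$ *preserves the SM property*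 if $(z_n)$ is SM whenever $(x_n)$ and $(y_n)$ are. Let $f(t)=\sum_{n\ge1}f_n\frac{t^n}{n!}\in\mathbb R[[t]]$ with $f_1\ne0$, and let $\bar f$ be its compositional inverse. For a series $g$ with $g(0)=1$ and $h\in\{f,\bar f\}$ define $S_{n,k}(h,g)$, $L_{n,k}(h)$, $\widetilde L_{n,k}(h)$ by $$g(t)e^{q h(t)}=\sum_{n\ge0}\Big(\sum_{k=0}^nS_{n,k}(h,g)q^k\Big)\frac{t^n}{n!},\qquad \log(1-q h(t))=-\sum_{n\ge1}\Big(\sum_{k=1}^nL_{n,k}(h)q^k\Big)\frac{t^n}{n!},\qquad \frac1{1-q h(t)}=\sum_{n\ge0}\Big(\sum_{k=0}^n\widetilde L_{n,k}(h)q^k\Big)\frac{t^n}{n!},$$ with the conventions $L_{0,0}(h)=1$ and $L_{n,0}(h)=L_{0,n}(h)=0$ for $n\ge1$. Put $S_n(f,g;q)=\sum_{k=0}^nS_{n,k}(f,g)q^k$ and $S_n^*(f,g;q)=q^nS_n(f,g;1/q)$. **Theorem.** Let $g(t)=\exp(\lambda f(t))$. Suppose that $1/\bar f'(t)$ is PF.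 Then: (i) with $\lambda,q$ indeterminates, both $(S_n(f,g;q))_{n\ge0}$ and $(S_n^*(f,g;q))_{n\ge0}$ are $(\lambda,q)$-SM and $3$-$(\lambda,q)$-log-convex; (ii) $(f_{n+1})_{n\ge0}$ is SM and $3$-log-convex; (iii) with $\lambda$ an indeterminate, $[S_{n,k}(f,g)]_{n,k\ge0}$ is $\lambda$-TP; (iv) the matrices $[L_{n,k}(f)]$, $[\widetilde L_{n,k}(f)]$, $[(-1)^{n-k}S_{n,k}(\bar f,1)]$, $[(-1)^{n-k}L_{n,k}(\bar f)]$ and $[(-1)^{n-k}\widetilde L_{n,k}(\bar f)]$ $(n,k\ge0)$ are TP; (v) the $A$-convolution preserves the SM property if $A$ is any of $[S_{n,k}(f,g)]_{n,k\ge0}$ with $\lambda\ge0$ real, $[S_{n+1,k+1}(f,1)]_{n,k\ge0}$, and $[\widetilde L_{n,k}(f)]_{n,k\ge0}$; (vi) if $1/\bar f'(t)=\prod_{i=1}^m(1+x_it)$ with $x_1,\dots,x_m\in\mathbb R$, then, with $\lambda,q$ indeterminates, $$\sum_{n\ge0}S_n(f,g;q)t^n=\cfrac{1}{1-\alpha_mt\prod\limits_{i_1=1}^m\cfrac{1}{1-\alpha_{m+i_1}t\prod\limits_{i_2=1}^m\cfrac{1}{1-\alpha_{m+i_1+i_2}t\prod\limits_{i_3=1}^m\cfrac1{1-\cdots}}}}$$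 and the same identity holds for $\sum_{n\ge0}S_n^*(f,g;q)t^n$ with $\beta$ in place of $\alpha$, where $$(\alpha_i)_{i\ge m}=(\lambda+q,\,x_1,\dots,x_m,\,\lambda+q,\,2x_1,\dots,2x_m,\,\lambda+q,\,3x_1,\dots,3x_m,\dots),$$ $$(\beta_i)_{i\ge m}=(q\lambda+1,\,qx_1,\dots,qx_m,\,q\lambda+1,\,2qx_1,\dots,2qx_m,\,q\lambda+1,\,3qx_1,\dots,3qx_m,\dots).$$ The infinite fraction is understood as the coefficientwise limit of its finite truncations in the ring of formal power series in $t$ over $\mathbb R[\lambda,q]$. -/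

import Mathlib

open PowerSeries

noncomputable section

namespace ShefferTP

/-! ### Total positivity, Pólya frequency, moment sequences

Positivity notions are stated relative to a set of "nonnegative" elements `P : R → Prop`:
nonnegative reals in `ℝ`, or polynomials with nonnegative coefficients in `ℝ[λ]` or `ℝ[λ][q]`. -/

/-- All minors (of all orders) of the infinite matrix `M` satisfy `P`. -/
def MinorsSatisfy {R : Type*} [CommRing R] (P : R → Prop) (M : ℕ → ℕ → R) : Prop :=
  ∀ (k : ℕ) (r c : Fin k → ℕ), StrictMono r → StrictMono c →
    P (Matrix.det (Matrix.of fun i j : Fin k => M (r i) (c j)))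

/-- A univariate real polynomial with nonnegative coefficients. -/
def NonnegCoeff (p : Polynomial ℝ) : Prop := ∀ i, 0 ≤ p.coeff i

/-- A real polynomial in two indeterminates, regarded as an element of `ℝ[λ][q]`,
with nonnegative coefficients. -/
def NonnegCoeff₂ (p : Polynomial (Polynomial ℝ)) : Prop := ∀ i j, 0 ≤ (p.coeff i).coeff j

/-- A real matrix is totally positive (TP). -/
def IsTP (M : ℕ → ℕ → ℝ) : Prop := MinorsSatisfy (fun x : ℝ => 0 ≤ x) M

/-- A matrix over `ℝ[λ]` is `λ`-totally positive. -/
def IsPolyTP (M : ℕ → ℕ → Polynomial ℝ) : Prop := MinorsSatisfy NonnegCoeff M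

/-- A sequence in `ℝ[λ, q]` is `(λ, q)`-Stieltjes moment: its Hankel matrix is `(λ, q)`-TP. -/
def IsPolySM₂ (a : ℕ → Polynomial (Polynomial ℝ)) : Prop :=
  MinorsSatisfy NonnegCoeff₂ fun i j => a (i + j)

/-- A formal power series is PF: the Toeplitz matrix `[a_{i-j}]` of its coefficients is TP. -/
def IsPF (φ : ℝ⟦X⟧) : Prop :=
  IsTP fun i j => if j ≤ i then coeff (i - j) φ else 0

/-- A real sequence is Stieltjes moment: `a k = ∫_{[0,∞)} x ^ k dμ(x)` for all `k`, for some
nonnegative measure `μ` on `[0, ∞)` (with finite moments). -/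
def IsSM (a : ℕ → ℝ) : Prop :=
  ∃ μ : MeasureTheory.Measure ℝ, μ (Set.Iio 0) = 0 ∧
    ∀ k : ℕ, MeasureTheory.Integrable (fun x : ℝ => x ^ k) μ ∧ a k = ∫ x, x ^ k ∂μ

/-- The operator `𝓛[a_i] = a_{i-1} a_{i+1} - a_i ^ 2` for `i ≥ 1`; the output is re-indexed to
start at `0`, so that its `i`-th term is `𝓛[a_{i+1}]` and the `i`-th term of the `m`-th iterate
is `𝓛^m[a_{i+m}]`. -/
def logConvexOp {R : Type*} [CommRing R] (a : ℕ → R) : ℕ → R :=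
  fun i => a i * a (i + 2) - a (i + 1) ^ 2

/-- `k`-log-convexity relative to `P`: all terms of `𝓛^m[a]` satisfy `P`, for all `m ≤ k`. -/
def IsLogConvexOfOrder {R : Type*} [CommRing R] (P : R → Prop) (k : ℕ) (a : ℕ → R) : Prop :=
  ∀ m ≤ k, ∀ i, P ((logConvexOp^[m] a) i)

/-- The `A`-convolution `z_n = ∑_{k=0}^n A_{n,k} x_k y_{n-k}` preserves the SM property. -/
def ConvolutionPreservesSM (A : ℕ → ℕ → ℝ) : Prop :=
  ∀ x y : ℕ → ℝ, IsSM x → IsSM y →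
    IsSM fun n => ∑ k ∈ Finset.range (n + 1), A n k * x k * y (n - k)

/-! ### Sheffer, logarithmic and fractional triangles -/

/-- `exp (c * f(t))`, for `f` with zero constant term. -/
def expMul {A : Type*} [CommRing A] [Algebra ℚ A] (c : A) (f : A⟦X⟧) : A⟦X⟧ :=
  (exp A).subst (C c * f)

/-- The Sheffer polynomial `S_n(f, g; q) ∈ A[q]`, given by
`∑ S_n(f, g; q) t^n / n! = g(t) exp (q f(t))`. -/
def shefferPoly {A : Type*} [CommRing A] [Algebra ℚ A] (f g : A⟦X⟧) (n : ℕ) : Polynomial A :=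
  n.factorial • coeff n
    (PowerSeries.map Polynomial.C g *
      expMul (Polynomial.X : Polynomial A) (PowerSeries.map Polynomial.C f))

/-- The Sheffer triangle: `S_{n,k}(f, g)` is the coefficient of `q ^ k` in `S_n(f, g; q)`. -/
def sheffer {A : Type*} [CommRing A] [Algebra ℚ A] (f g : A⟦X⟧) (n k : ℕ) : A :=
  (shefferPoly f g n).coeff k

/-- The power series `q f(t)` over `ℝ[q]`. -/
def qMul (f : ℝ⟦X⟧) : (Polynomial ℝ)⟦X⟧ :=
  C (Polynomial.X : Polynomial ℝ) * PowerSeries.map Polynomial.C f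

/-- The logarithmic polynomial: `log (1 - q f(t)) = - ∑_{n ≥ 1} L_n(f; q) t^n / n!`, and
`L_0(f; q) = 1` by convention. -/
def logPoly (f : ℝ⟦X⟧) (n : ℕ) : Polynomial ℝ :=
  if n = 0 then 1
  else -(n.factorial • coeff n ((PowerSeries.log (Polynomial ℝ)).subst (-qMul f)))

/-- The logarithmic triangle `L_{n,k}(f)`. -/
def logTriangle (f : ℝ⟦X⟧) (n k : ℕ) : ℝ := (logPoly f n).coeff k

/-- The fractional polynomial: `1 / (1 - q f(t)) = ∑ L̃_n(f; q) t^n / n!`. -/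
def fracPoly (f : ℝ⟦X⟧) (n : ℕ) : Polynomial ℝ :=
  n.factorial • coeff n (invOfUnit (1 - qMul f) 1)

/-- The fractional triangle `L̃_{n,k}(f)`. -/
def fracTriangle (f : ℝ⟦X⟧) (n k : ℕ) : ℝ := (fracPoly f n).coeff k

/-- The matrix `[(-1)^{n-k} M_{n,k}]`. -/
def signed (M : ℕ → ℕ → ℝ) (n k : ℕ) : ℝ := (-1) ^ (n + k) * M n k

/-- `f` with its coefficients regarded as constants of `ℝ[λ]`. -/
def liftSeries (f : ℝ⟦X⟧) : (Polynomial ℝ)⟦X⟧ := PowerSeries.map Polynomial.C f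

/-- `g(t) = exp (λ f(t))` with `λ` an indeterminate, the variable of the coefficient ring
`ℝ[λ]`. -/
def expLam (f : ℝ⟦X⟧) : (Polynomial ℝ)⟦X⟧ := expMul Polynomial.X (liftSeries f)

/-- `S_n(f, exp (λ f); q)` with `λ` and `q` indeterminates, as an element of `ℝ[λ][q]`. -/
def shefferExp (f : ℝ⟦X⟧) (n : ℕ) : Polynomial (Polynomial ℝ) :=
  shefferPoly (liftSeries f) (expLam f) n

/-- The reciprocal polynomial `S_n^*(f, exp (λ f); q) = q^n S_n(f, exp (λ f); 1/q)`. -/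
def shefferExpStar (f : ℝ⟦X⟧) (n : ℕ) : Polynomial (Polynomial ℝ) :=
  Polynomial.reflect n (shefferExp f n)

/-- The exponential coefficients `f_n` in `f(t) = ∑ f_n t^n / n!`. -/
def egfCoeff (f : ℝ⟦X⟧) (n : ℕ) : ℝ := n.factorial * coeff n f

/-! ### `m`-branched Stieltjes-type continued fractions -/

/-- Convergents of the `m`-branched Stieltjes-type continued fraction; here `a j` stands for the
coefficient `α_{m+j}`. `branchedConvergent m a N k` is the fraction
`1 / (1 - a_k t ∏_{i=1}^m 1 / (1 - a_{k+i} t ∏_{i'=1}^m 1 / (1 - a_{k+i+i'} t ⋯)))`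
with `N` levels, the first one having the coefficient `a_k`. -/
def branchedConvergent {R : Type*} [CommRing R] (m : ℕ) (a : ℕ → R) : ℕ → ℕ → R⟦X⟧
  | 0, _ => 1
  | N + 1, k =>
      invOfUnit (1 - C (a k) * X * ∏ i : Fin m, branchedConvergent m a N (k + (i + 1))) 1

/-- `F` is the value of the `m`-branched Stieltjes-type continued fraction with coefficients
`α_{m+j} = a j`: the convergents tend to `F` coefficientwise (each coefficient is eventually
constant). -/
def HasBranchedFraction {R : Type*} [CommRing R] (m : ℕ) (a : ℕ → R) (F : R⟦X⟧) : Prop :=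
  ∀ n, ∀ᶠ N in Filter.atTop, coeff n (branchedConvergent m a N 0) = coeff n F

/-- The sequence `c, y_1, …, y_m, c, 2 y_1, …, 2 y_m, c, 3 y_1, …, 3 y_m, …`, indexed from `0`
(`y i` is `y_{i+1}`). -/
def blockSeq {R : Type*} [CommRing R] {m : ℕ} (c : R) (y : Fin m → R) (j : ℕ) : R :=
  if h : j % (m + 1) = 0 then c
  else ((j / (m + 1) + 1 : ℕ) : R) *
    y ⟨j % (m + 1) - 1, by have := Nat.mod_lt j (show m + 1 > 0 by omega); omega⟩

end ShefferTP

end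

/-! Differentiating `f̄(f(t)) = t` gives `f' = φ(f)` with `φ = 1 / f̄'`. For `E = exp(c f)`, the
product rule together with `f' = ∑ φ_i f^i` turns row `n` of the triangle `(n!/k!) [t^n] E f^k` into
row `n + 1` through right multiplication by the production matrix `T (c I + Δ)`, where `T = [(j!/k!)
φ_{j-k}]` and `Δ` has ones on the superdiagonal. PF-ness of `φ` makes `T` totally positive, the
bidiagonal factor is totally positive, and Cauchy–Binet handles the product. A totally positive
production matrix makes its output triangle totally positive (`TP.of_production`) and the zeroth
column of that triangle Hankel-totally positive (`TP.hankel_of_production`).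

A second parameter `w` covers all variants at once. Replacing `f` by `F = f(w t)/w` replaces `φ(t)`
by `φ(w t)`, and the zeroth column becomes `∑ S_{n,k}(f,1) c^k w^{n-k}`. Then `(c, w) = (λ + q, 1)`
gives `S_n`, and `(qλ + 1, q)` gives `S_n^*`. Using the weight `F' E` instead of `E` turns the
production matrix into `(c I + Δ) T` and yields `S_{n+1,k+1}`, hence `f_{n+1}`.

Log-convexity of order three follows by writing the iterates of `𝓛` through Hankel minors. The
passage from Hankel minors to measures is Stieltjes' theorem, obtained from Haviland's theorem
(Riesz extension and Riesz–Markov–Kakutani). Convolution preservation reduces, by integrating over a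
product measure, to geometric sequences, whose `A`-convolutions are again sums of the form above
with `c, w` real. The triangles of `f̄` have `f̄' = 1/φ`, and Jacobi's complementary minors show
that `1/φ(-t)` is PF; the logarithmic and fractional triangles are column rescalings of the Sheffer
triangle. For (vi), the series `exp(c F) F^r ∏_{l<i} (1 + y_l F)` satisfy an Euler–Gauss recurrence
that closes up because the full product is `F'`. -/

namespace ShefferTP

/-! ### The Cauchy–Binet formula -/

section CauchyBinet

variable {R : Type*} [CommRing R]

theorem det_mul_eq_sum_fun {k N : ℕ} (A : Matrix (Fin k) (Fin N) R) (B : Matrix (Fin N) (Fin k) R) :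
    (A * B).det = ∑ p : Fin k → Fin N, (∏ i, A i (p i)) * (B.submatrix p id).det := by
  have h : (A * B) = fun i => ∑ j, A i j • B j := by
    funext i l
    simp [Matrix.mul_apply, Finset.sum_apply]
  have h2 := (Matrix.detRowAlternating (n := Fin k) (R := R)).toMultilinearMap.map_sum
    (fun i j => A i j • B j)
  change Matrix.detRowAlternating (A * B) = _
  rw [h]
  refine h2.trans (Finset.sum_congr rfl fun p _ => ?_)
  exact (Matrix.detRowAlternating (n := Fin k) (R := R)).toMultilinearMap.map_smul_univ
    (fun i => A i (p i)) (fun i => B (p i))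

/-- The **Cauchy–Binet formula**. -/
theorem cauchyBinet {k N : ℕ} (A : Matrix (Fin k) (Fin N) R) (B : Matrix (Fin N) (Fin k) R) :
    (A * B).det =
      ∑ s : Fin k ↪o Fin N, (A.submatrix id s).det * (B.submatrix s id).det := by
  classical
  rw [det_mul_eq_sum_fun]
  -- An injective choice of rows factors uniquely as an increasing one after a permutation; a
  -- non-injective choice repeats a row and contributes zero.
  have key : ∑ x : (Fin k ↪o Fin N) × Equiv.Perm (Fin k),
      (∏ i, A i (x.1 (x.2 i))) * (B.submatrix (x.1 ∘ x.2) id).det =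
      ∑ p : Fin k → Fin N, (∏ i, A i (p i)) * (B.submatrix p id).det := by
    refine Finset.sum_of_injOn (fun x => x.1 ∘ x.2) ?_ (by simp) ?_ (by simp)
    · rintro ⟨s, σ⟩ - ⟨s', σ'⟩ - h
      have h' : (s : Fin k → Fin N) ∘ σ = s' ∘ σ' := h
      have hr : Set.range s = Set.range s' := by
        have := congrArg Set.range h'
        rwa [Set.range_comp, Set.range_comp, σ.surjective.range_eq, σ'.surjective.range_eq,
          Set.image_univ, Set.image_univ] at this
      have hs : s = s' := by
        ext1 i
        exact congrFun ((StrictMono.range_inj s.strictMono s'.strictMono).1 hr) i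
      subst hs
      have : σ = σ' := by
        ext1 i
        exact s.injective (congrFun h' i)
      rw [this]
    · intro p _ hp
      by_cases hinj : Function.Injective p
      · refine absurd ?_ hp
        have hmono : StrictMono (p ∘ Tuple.sort p) :=
          (Tuple.monotone_sort p).strictMono_of_injective
            (hinj.comp (Tuple.sort p).injective)
        refine ⟨(OrderEmbedding.ofStrictMono _ hmono, (Tuple.sort p)⁻¹), by simp, ?_⟩
        funext i
        simp
      · simp only [Function.Injective, not_forall] at hinj
        obtain ⟨a, b, hab, hne⟩ := hinj
        rw [Matrix.det_zero_of_row_eq hne (by funext l; simp [hab]), mul_zero]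
  rw [← key, Fintype.sum_prod_type]
  refine Finset.sum_congr rfl fun s _ => ?_
  have h1 : ∀ σ : Equiv.Perm (Fin k), (B.submatrix (s ∘ σ) id).det =
      Equiv.Perm.sign σ * (B.submatrix s id).det := fun σ => by
    rw [← Matrix.det_permute σ]; rfl
  simp_rw [h1, ← Matrix.det_transpose (A.submatrix id s), Matrix.det_apply', Finset.sum_mul]
  refine Finset.sum_congr rfl fun σ _ => ?_
  simp only [Matrix.transpose_apply, Matrix.submatrix_apply, id]
  ring

end CauchyBinet

/-! ### Total positivity with respect to a subsemiring -/

section TP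

variable {R : Type*} [CommRing R] (C : Subsemiring R)

/-- Total positivity with respect to a subsemiring of nonnegative elements. -/
abbrev TP (M : ℕ → ℕ → R) : Prop := MinorsSatisfy (· ∈ C) M

variable {C}

theorem TP.transpose {M : ℕ → ℕ → R} (h : TP C M) : TP C fun i j => M j i := by
  intro k r c hr hc
  have := h k c r hc hr
  rw [← Matrix.det_transpose] at this
  exact this

theorem TP.apply_mem {M : ℕ → ℕ → R} (h : TP C M) (i j : ℕ) : M i j ∈ C := by
  simpa using h 1 (fun _ => i) (fun _ => j) (Subsingleton.strictMono _) (Subsingleton.strictMono _)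

/-- A minor of a product is in the cone if the relevant minors of the factors are. -/
theorem minor_mem_of_mul {A B M : ℕ → ℕ → R} {k : ℕ} {r c : Fin k → ℕ} (N : ℕ)
    (hM : ∀ i j, M (r i) (c j) = ∑ l ∈ Finset.range N, A (r i) l * B l (c j))
    (hA : ∀ s : Fin k → ℕ, StrictMono s → (Matrix.of fun i j => A (r i) (s j)).det ∈ C)
    (hB : ∀ s : Fin k → ℕ, StrictMono s → (Matrix.of fun i j => B (s i) (c j)).det ∈ C) :
    (Matrix.of fun i j => M (r i) (c j)).det ∈ C := by
  have h : (Matrix.of fun i j => M (r i) (c j)) =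
      (Matrix.of fun (i : Fin k) (l : Fin N) => A (r i) l) *
        (Matrix.of fun (l : Fin N) (j : Fin k) => B l (c j)) := by
    ext i j
    simp [Matrix.mul_apply, hM, Finset.sum_range]
  rw [h, cauchyBinet]
  refine sum_mem fun s _ => mul_mem ?_ ?_
  · exact hA (fun j => s j) (Fin.val_strictMono.comp s.strictMono)
  · exact hB (fun j => s j) (Fin.val_strictMono.comp s.strictMono)

/-- A minor involves only finitely many entries, so it suffices that each finite corner of the
infinite product is given by one finite sum; this avoids any convergence question. -/
theorem TP.mul {A B M : ℕ → ℕ → R} (hA : TP C A) (hB : TP C B)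
    (hM : ∀ K, ∃ N, ∀ i < K, ∀ j < K, M i j = ∑ l ∈ Finset.range N, A i l * B l j) :
    TP C M := by
  intro k r c hr hc
  obtain ⟨N, hN⟩ := hM (∑ i, r i + ∑ i, c i + 1)
  refine minor_mem_of_mul N (fun i j => hN _ ?_ _ ?_) (fun s hs => hA k r s hr hs)
    (fun s hs => hB k s c hs hc)
  · have := Finset.single_le_sum (f := r) (fun _ _ => Nat.zero_le _) (Finset.mem_univ i)
    omega
  · have := Finset.single_le_sum (f := c) (fun _ _ => Nat.zero_le _) (Finset.mem_univ j)
    omega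

theorem TP.map {S : Type*} [CommRing S] {D : Subsemiring S} (φ : R →+* S)
    (hφ : ∀ x ∈ C, φ x ∈ D) {M : ℕ → ℕ → R} (h : TP C M) : TP D fun i j => φ (M i j) := by
  intro k r c hr hc
  have := hφ _ (h k r c hr hc)
  rw [RingHom.map_det] at this
  exact this

theorem TP.scale {M : ℕ → ℕ → R} (h : TP C M) {u v : ℕ → R} (hu : ∀ i, u i ∈ C)
    (hv : ∀ i, v i ∈ C) : TP C fun i j => u i * M i j * v j := by
  intro k r c hr hc
  have h1 := Matrix.det_mul_column (fun i => u (r i))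
    (Matrix.of fun i j => v (c j) * M (r i) (c j))
  have h2 := Matrix.det_mul_row (fun i => v (c i)) (Matrix.of fun i j => M (r i) (c j))
  have : (Matrix.of fun i j => u (r i) * M (r i) (c j) * v (c j)) =
      (Matrix.of fun i j => u (r i) * (Matrix.of fun i j => v (c j) * M (r i) (c j)) i j) := by
    ext i j; simp; ring
  rw [this, h1]
  simp only [Matrix.of_apply] at h2 ⊢
  rw [h2]
  exact mul_mem (prod_mem fun _ _ => hu _) (mul_mem (prod_mem fun _ _ => hv _) (h k r c hr hc))

/-- Scaling the entry `(i, j)` of a lower triangular matrix by `w ^ (i - j)`. -/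
theorem TP.scale_pow_sub {M : ℕ → ℕ → R} (h : TP C M) (h0 : ∀ i j, i < j → M i j = 0) {w : R}
    (hw : w ∈ C) : TP C fun i j => w ^ (i - j) * M i j := by
  intro k r c hr hc
  have : (Matrix.of fun i j => w ^ (r i - c j) * M (r i) (c j)).det =
      w ^ (∑ i, r i - ∑ i, c i) * (Matrix.of fun i j => M (r i) (c j)).det := by
    rw [Matrix.det_apply', Matrix.det_apply', Finset.mul_sum]
    refine Finset.sum_congr rfl fun σ _ => ?_
    simp only [Matrix.of_apply, Finset.prod_mul_distrib]
    -- Every nonvanishing term of the expansion carries the same total power of `w`, since no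
    -- subtraction is truncated there. Conjugation by powers of `w` is not available because `w`
    -- need not be invertible.
    by_cases hσ : ∀ i, c i ≤ r (σ i)
    · rw [Finset.prod_pow_eq_pow_sum, Finset.sum_tsub_distrib _ (fun i _ => hσ i),
        Equiv.sum_comp σ r]
      ring
    · push Not at hσ
      obtain ⟨i, hi⟩ := hσ
      rw [Finset.prod_eq_zero (f := fun x => M (r (σ x)) (c x)) (Finset.mem_univ i) (h0 _ _ hi)]
      simp
  rw [this]
  exact mul_mem (pow_mem hw _) (h k r c hr hc)

/-- Prepending a zero column, or shifting columns to the right. -/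
theorem TP.shift_col {M : ℕ → ℕ → R} (h : TP C M) :
    TP C fun i j => if j = 0 then 0 else M i (j - 1) := by
  intro k r c hr hc
  by_cases hc0 : ∀ j, c j ≠ 0
  · have : (Matrix.of fun i j => if c j = 0 then 0 else M (r i) (c j - 1)) =
        (Matrix.of fun i j => M (r i) (c j - 1)) := by
      ext i j; simp [hc0 j]
    rw [this]
    exact h k r (fun j => c j - 1) hr fun i j hij => by
      have := hc hij
      have := hc0 i
      change c i - 1 < c j - 1
      omega
  · push Not at hc0
    obtain ⟨j, hj⟩ := hc0
    rw [Matrix.det_eq_zero_of_column_eq_zero j fun i => by simp [hj]]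
    exact zero_mem C

/-- Expansion of a determinant whose first row is supported in the first column. -/
theorem det_eq_of_first_row {n : ℕ} (A : Matrix (Fin (n + 1)) (Fin (n + 1)) R)
    (h : ∀ j : Fin n, A 0 j.succ = 0) :
    A.det = A 0 0 * (A.submatrix Fin.succ Fin.succ).det := by
  rw [Matrix.det_succ_row_zero, Fin.sum_univ_succ]
  simp [h]

/-- The upper bidiagonal matrix `c I + Δ`. -/
def upperBidiag (c : R) (i j : ℕ) : R := if j = i then c else if j = i + 1 then 1 else 0

/-- The position of the first column relative to the first row decides the expansion: to the left,
the first column is zero; on the diagonal, that column has a single nonzero entry; to the right, the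
first row has at most one. -/
theorem tp_upperBidiag {c : R} (hc : c ∈ C) : TP C (upperBidiag c) := by
  intro k
  induction k with
  | zero => intro r s _ _; simp
  | succ k ih =>
    intro r s hr hs
    have ih' := ih (r ∘ Fin.succ) (s ∘ Fin.succ) (hr.comp Fin.strictMono_succ)
      (hs.comp Fin.strictMono_succ)
    have hs0 : ∀ j : Fin k, s 0 < s j.succ := fun j => hs (Fin.succ_pos j)
    have hr0 : ∀ j : Fin k, r 0 < r j.succ := fun j => hr (Fin.succ_pos j)
    rcases lt_trichotomy (s 0) (r 0) with h | h | h
    · rw [Matrix.det_eq_zero_of_column_eq_zero 0 fun i => ?_]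
      · exact zero_mem C
      · have : r 0 ≤ r i := hr.monotone (Fin.zero_le i)
        simp only [Matrix.of_apply, upperBidiag]
        rw [if_neg (by omega), if_neg (by omega)]
    · rw [← Matrix.det_transpose, det_eq_of_first_row, ← Matrix.det_transpose]
      · refine mul_mem ?_ ih'
        simpa [upperBidiag, h] using hc
      · intro j
        have := hr0 j
        simp only [Matrix.transpose_apply, Matrix.of_apply, upperBidiag]
        rw [if_neg (by omega), if_neg (by omega)]
    · rw [det_eq_of_first_row]
      · refine mul_mem ?_ ih'
        simp only [Matrix.of_apply, upperBidiag]
        rw [if_neg (by omega)]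
        split_ifs
        · exact one_mem C
        · exact zero_mem C
      · intro j
        have := hs0 j
        simp only [Matrix.of_apply, upperBidiag]
        rw [if_neg (by omega), if_neg (by omega)]

/-- The output matrix of a totally positive production matrix is totally positive. -/
theorem TP.of_production {P O : ℕ → ℕ → R} (hP : TP C P) (h00 : O 0 0 ∈ C)
    (h0 : ∀ j, O 0 (j + 1) = 0)
    (hO : ∀ K, ∃ N, ∀ i < K, ∀ j < K, O (i + 1) j = ∑ l ∈ Finset.range N, O i l * P l j) :
    TP C O := by
  -- Rows of positive index are rows of the product with `P`, so Cauchy–Binet lowers the bound on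
  -- the row indices by one.
  have pos : ∀ K, (∀ k (r c : Fin k → ℕ), StrictMono r → StrictMono c → (∀ i, r i < K) →
      (Matrix.of fun i j => O (r i) (c j)).det ∈ C) →
      ∀ k (r c : Fin k → ℕ), StrictMono r → StrictMono c → (∀ i, r i < K) →
      (Matrix.of fun i j => O (r i + 1) (c j)).det ∈ C := by
    intro K ih k r c hr hc hK
    obtain ⟨N, hN⟩ := hO (K + ∑ i, c i + 1)
    have := minor_mem_of_mul (C := C) (A := O) (B := P) (M := fun i j => O (i + 1) j) (r := r)
      (c := c) N (fun i j => hN _ (by have := hK i; omega) _ ?_) (fun s hs => ih k r s hr hs hK)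
      (fun s hs => hP k s c hs hc)
    · exact this
    · have := Finset.single_le_sum (f := c) (fun _ _ => Nat.zero_le _) (Finset.mem_univ j)
      omega
  have key : ∀ K, ∀ k (r c : Fin k → ℕ), StrictMono r → StrictMono c → (∀ i, r i < K) →
      (Matrix.of fun i j => O (r i) (c j)).det ∈ C := by
    intro K
    induction K with
    | zero =>
      rintro (_ | k) r c hr hc hK
      · simp
      · exact absurd (hK 0) (by simp)
    | succ K ih =>
      have pos' : ∀ k (r c : Fin k → ℕ), StrictMono r → StrictMono c → (∀ i, r i < K + 1) →
          (∀ i, 0 < r i) → (Matrix.of fun i j => O (r i) (c j)).det ∈ C := by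
        intro k r c hr hc hK h
        have := pos K ih k (fun i => r i - 1) c (fun i j hij => ?_) hc fun i => ?_
        · have e : ∀ i, r i - 1 + 1 = r i := fun i => by have := h i; omega
          simpa only [e] using this
        · have := hr hij
          have := h i
          change r i - 1 < r j - 1
          omega
        · have := hK i
          have := h i
          omega
      rintro (_ | k) r c hr hc hK
      · simp
      -- Row zero is supported in column zero, so a minor using it expands along it into a minor
      -- with positive rows only.
      · rcases Nat.eq_zero_or_pos (r 0) with h | h
        · have hs0 : ∀ j : Fin k, c 0 < c j.succ := fun j => hc (Fin.succ_pos j)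
          rw [det_eq_of_first_row]
          · refine mul_mem ?_ (pos' k (r ∘ Fin.succ) (c ∘ Fin.succ)
              (hr.comp Fin.strictMono_succ) (hc.comp Fin.strictMono_succ) (fun i => hK _)
              fun i => lt_of_le_of_lt (Nat.zero_le _) (hr (Fin.succ_pos i)))
            simp only [Matrix.of_apply, h]
            rcases hc' : c 0 with _ | m
            · exact h00
            · rw [h0]; exact zero_mem C
          · intro j
            obtain ⟨m, hm⟩ := Nat.exists_eq_succ_of_ne_zero (by have := hs0 j; omega : c j.succ ≠ 0)
            simp [h, hm, h0]
        · exact pos' _ r c hr hc hK fun i => lt_of_lt_of_le h (hr.monotone (Fin.zero_le i))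
  exact fun k r c hr hc => key (∑ i, r i + 1) k r c hr hc fun i => by
    have := Finset.single_le_sum (f := r) (fun _ _ => Nat.zero_le _) (Finset.mem_univ i)
    omega

/-- The column `(P ^ j)_{k, 0}`, as a function of `j` and `k`, for a lower Hessenberg matrix. -/
def powColumn (P : ℕ → ℕ → R) : ℕ → ℕ → R
  | 0, k => if k = 0 then 1 else 0
  | j + 1, k => ∑ l ∈ Finset.range (k + 2), powColumn P j l * P k l

/-- Read with `j` as the row index, this array is the output matrix of the transpose of `P`. -/
theorem TP.powColumn {P : ℕ → ℕ → R} (hP : TP C P) (hH : ∀ i j, i + 1 < j → P i j = 0) :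
    TP C (powColumn P) := by
  refine TP.of_production hP.transpose (by simp [ShefferTP.powColumn, one_mem])
    (by simp [ShefferTP.powColumn]) fun K => ⟨K + 2, fun i _ j hj => ?_⟩
  rw [ShefferTP.powColumn]
  refine Finset.sum_subset (by simp; omega) fun l _ hl => ?_
  rw [hH _ _ (by simp at hl; omega), mul_zero]

/-- The zeroth column of the output matrix of a totally positive production matrix is a
Hankel-totally positive sequence. -/
theorem TP.hankel_of_production {P O : ℕ → ℕ → R} (hP : TP C P)
    (hH : ∀ i j, i + 1 < j → P i j = 0) (h00 : O 0 0 ∈ C) (hO0 : ∀ i j, i < j → O i j = 0)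
    (hO : ∀ i j, O (i + 1) j = ∑ l ∈ Finset.range (i + 1), O i l * P l j) :
    TP C fun i j => O (i + j) 0 := by
  have hsum : ∀ i j N, i + 1 ≤ N → O (i + 1) j = ∑ l ∈ Finset.range N, O i l * P l j := by
    intro i j N hN
    rw [hO]
    refine Finset.sum_subset (by simpa using hN) fun l _ hl => ?_
    rw [hO0 _ _ (by simp at hl; omega), zero_mul]
  have h1 : TP C O := TP.of_production hP h00 (fun j => hO0 _ _ (Nat.succ_pos j))
    fun K => ⟨K + 1, fun i hi j _ => hsum i j _ (by omega)⟩
  -- The Hankel matrix factors as `O` times an array of powers: `O` is the zeroth-row array of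
  -- powers of `P`, and `i + j` steps split into `i` steps followed by `j` steps. Both factors are
  -- totally positive.
  have key : ∀ j i N, i + 1 ≤ N →
      O (i + j) 0 = ∑ k ∈ Finset.range N, O i k * ShefferTP.powColumn P j k := by
    intro j
    induction j with
    | zero =>
      intro i N hN
      simp only [ShefferTP.powColumn, mul_ite, mul_one, mul_zero, Finset.sum_ite_eq',
        Finset.mem_range]
      rw [if_pos (by omega)]; rfl
    | succ j ih =>
      intro i N hN
      rw [show i + (j + 1) = (i + 1) + j by ring, ih (i + 1) (N + 2) (by omega)]
      simp_rw [hsum i _ N hN, Finset.sum_mul]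
      rw [Finset.sum_comm]
      refine Finset.sum_congr rfl fun l hl => ?_
      rw [ShefferTP.powColumn, Finset.mul_sum]
      symm
      refine Finset.sum_subset_zero_on_sdiff (by simp at hl ⊢; omega) (fun x hx => ?_)
        (fun x _ => by ring)
      rw [hH l x (by simp at hx; omega)]
      ring
  exact TP.mul h1 (hP.powColumn hH).transpose fun K =>
    ⟨K + 1, fun i hi j _ => key j i _ (by omega)⟩

/-! ### Log-convexity of order three -/

/-- The iterates of `𝓛` are positive combinations of products of contiguous Hankel minors. With
`D_i` the minor of order 3 starting at `a_i`, the second iterate is `a_{i+2} D_i`. In the third, the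
difference `D_i D_{i+2} - D_{i+1}^2` is, by the Desnanot–Jacobi identity, the minor of order 4 times
its central minor of order 2. -/
theorem isLogConvexOfOrder_three {a : ℕ → R} (h : TP C fun i j => a (i + j)) :
    IsLogConvexOfOrder (· ∈ C) 3 a := by
  have minor : ∀ n m, (Matrix.of fun i j : Fin n => a (m + i + j)).det ∈ C := fun n m =>
    h n (fun i => m + i) (fun i => i) (fun i j hij => by simpa using hij) Fin.val_strictMono
  have m1 : ∀ m, a m ∈ C := fun m => by simpa using h.apply_mem m 0
  have m2 := minor 2
  have m3 := minor 3
  have m4 := minor 4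
  have e1 : ∀ i, logConvexOp a i ∈ C := fun i => by
    convert m2 i using 1
    simp [Matrix.det_fin_two, logConvexOp]
    ring
  have e2 : ∀ i, (logConvexOp^[2] a) i =
      a (i + 2) * (Matrix.of fun k l : Fin 3 => a (i + k + l)).det := fun i => by
    simp [Matrix.det_fin_three, logConvexOp]
    ring_nf
  have e3 : ∀ i, (logConvexOp^[3] a) i =
      logConvexOp a (i + 2) * ((Matrix.of fun k l : Fin 3 => a (i + k + l)).det *
        (Matrix.of fun k l : Fin 3 => a (i + 2 + k + l)).det) + a (i + 3) ^ 2 *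
        (logConvexOp a (i + 2) * (Matrix.of fun k l : Fin 4 => a (i + k + l)).det) := fun i => by
    simp only [Function.iterate_succ, Function.iterate_zero, Function.comp, id,
      logConvexOp, Matrix.det_fin_three, Matrix.det_succ_row_zero (n := 3), Fin.sum_univ_four,
      Matrix.submatrix_apply, Matrix.of_apply]
    simp [Fin.succAbove]
    ring_nf
  intro m hm i
  interval_cases m
  · exact m1 i
  · exact e1 i
  · rw [e2]
    exact mul_mem (m1 _) (m3 i)
  · rw [e3]
    exact add_mem (mul_mem (e1 _) (mul_mem (m3 _) (m3 _)))
      (mul_mem (pow_mem (m1 _) 2) (mul_mem (e1 _) (m4 _)))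

end TP

/-! ### Complementary minors of the inverse, and reciprocals of PF series -/

section Jacobi

open Equiv

/-- The permutation is a shuffle, so its inversions are exactly the pairs where an element of the
second block lands below one of the first. The image of the `i`-th element of the first block
exceeds `i` by the number of such pairs. -/
theorem sign_of_strictMono_sum {k m : ℕ} (e : Fin k ⊕ Fin m ≃ Fin (k + m))
    (hl : StrictMono (e ∘ Sum.inl)) (hr : StrictMono (e ∘ Sum.inr)) :
    (Perm.sign (finSumFinEquiv.symm.trans e) : ℤ) =
      (-1) ^ (∑ i : Fin k, (e (Sum.inl i) : ℕ) + ∑ i : Fin k, (i : ℕ)) := by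
  classical
  have hcount : ∀ i : Fin k, (e (Sum.inl i) : ℕ) =
      i + (Finset.univ.filter fun j : Fin m => e (Sum.inr j) < e (Sum.inl i)).card := by
    intro i
    have h1 : (Finset.univ.filter fun x : Fin (k + m) => x < e (Sum.inl i)).card =
        (e (Sum.inl i) : ℕ) := by
      rw [show (Finset.univ.filter fun x : Fin (k + m) => x < e (Sum.inl i)) =
        Finset.Iio (e (Sum.inl i)) by ext; simp]
      simp
    have h2 : (Finset.univ.filter fun x : Fin k => x < i).card = i := by
      rw [show (Finset.univ.filter fun x : Fin k => x < i) = Finset.Iio i by ext; simp]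
      simp
    rw [← h1, Finset.card_filter, ← Equiv.sum_comp e, Fintype.sum_sum_type, ← Finset.card_filter,
      ← Finset.card_filter]
    congr 1
    rw [← h2]
    congr 1
    ext x
    simpa using hl.lt_iff_lt (a := x) (b := i)
  have hsign : (Perm.sign (finSumFinEquiv.symm.trans e) : ℤ) =
      ∏ j : Fin m, ∏ i : Fin k, if e (Sum.inl i) < e (Sum.inr j) then (1 : ℤ) else -1 := by
    rw [Perm.sign_eq_prod_prod_Iio, Fin.prod_univ_add]
    rw [Finset.prod_eq_one, one_mul]
    · push_cast
      refine Finset.prod_congr rfl fun j _ => ?_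
      rw [show Finset.Iio (Fin.natAdd k j) =
        Finset.univ.filter fun x => x < Fin.natAdd k j by ext; simp, Finset.prod_filter,
        Fin.prod_univ_add]
      have hA : ∀ i : Fin k, Fin.castAdd m i < Fin.natAdd k j := fun i => by
        rw [Fin.lt_def]; simp; omega
      rw [Finset.prod_eq_one (s := (Finset.univ : Finset (Fin m)))]
      · simp [hA]
        refine Finset.prod_congr rfl fun i _ => ?_
        split_ifs <;> rfl
      · intro i _
        split_ifs with h1 h2 <;> try simp
        refine absurd ?_ h2
        have : i < j := by simpa using h1
        simp only [Equiv.trans_apply, finSumFinEquiv_symm_apply_natAdd]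
        exact hr this
    · intro j _
      refine Finset.prod_eq_one fun i hi => ?_
      have hi' : (i : ℕ) < j := Fin.lt_def.1 (Finset.mem_Iio.1 hi)
      obtain ⟨i', rfl⟩ : ∃ i' : Fin k, i = Fin.castAdd m i' := ⟨⟨i, by omega⟩, rfl⟩
      have : i' < j := Fin.lt_def.2 hi'
      rw [if_pos]
      simp only [Equiv.trans_apply, finSumFinEquiv_symm_apply_castAdd]
      exact hl this
  rw [hsign, Finset.prod_comm]
  have hi : ∀ i : Fin k, (∏ j : Fin m, if e (Sum.inl i) < e (Sum.inr j) then (1 : ℤ) else -1) =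
      (-1) ^ ((e (Sum.inl i) : ℕ) + i) := by
    intro i
    have : (∏ j : Fin m, if e (Sum.inl i) < e (Sum.inr j) then (1 : ℤ) else -1) =
        (-1) ^ (Finset.univ.filter fun j : Fin m => e (Sum.inr j) < e (Sum.inl i)).card := by
      rw [Finset.prod_ite, Finset.prod_const_one, one_mul, Finset.prod_const]
      congr 2
      ext j
      have : e (Sum.inl i) ≠ e (Sum.inr j) := fun h => by simpa using e.injective h
      simp only [Finset.mem_filter, Finset.mem_univ, true_and, not_lt]
      exact ⟨fun h => lt_of_le_of_ne h this.symm, le_of_lt⟩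
    rw [this, hcount i, add_right_comm, pow_add, ← two_mul, pow_mul]
    simp
  simp_rw [hi, Finset.prod_pow_eq_pow_sum, Finset.sum_add_distrib]

/-- **Jacobi's complementary minor formula**. -/
theorem det_submatrix_inverse {R : Type*} [CommRing R] {k m : ℕ}
    {A B : Matrix (Fin (k + m)) (Fin (k + m)) R} (hAB : A * B = 1)
    (e f : Fin k ⊕ Fin m ≃ Fin (k + m))
    (hel : StrictMono (e ∘ Sum.inl)) (her : StrictMono (e ∘ Sum.inr))
    (hfl : StrictMono (f ∘ Sum.inl)) (hfr : StrictMono (f ∘ Sum.inr)) :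
    A.det * (B.submatrix (e ∘ Sum.inl) (f ∘ Sum.inl)).det =
      (-1) ^ (∑ i : Fin k, (e (Sum.inl i) : ℕ) + ∑ i : Fin k, (f (Sum.inl i) : ℕ)) *
        (A.submatrix (f ∘ Sum.inr) (e ∘ Sum.inr)).det := by
  have h1 : (A.submatrix f e) * (B.submatrix e f) = 1 := by
    rw [Matrix.submatrix_mul_equiv, hAB, Matrix.submatrix_one_equiv]
  -- After reordering, the inverse relation is multiplied only against the first block column of
  -- `B`; taking determinants of the two block triangular matrices isolates the two complementary
  -- minors.
  have h2 : (A.submatrix f e) * Matrix.fromBlocks (B.submatrix (e ∘ Sum.inl) (f ∘ Sum.inl)) 0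
      (B.submatrix (e ∘ Sum.inr) (f ∘ Sum.inl)) 1 =
      Matrix.fromBlocks 1 (A.submatrix (f ∘ Sum.inl) (e ∘ Sum.inr)) 0
        (A.submatrix (f ∘ Sum.inr) (e ∘ Sum.inr)) := by
    ext i j
    rcases j with j | j
    · have := congrFun (congrFun h1 i) (Sum.inl j)
      rw [Matrix.mul_apply, Fintype.sum_sum_type] at this ⊢
      rcases i with i | i <;> simpa [Matrix.one_apply] using this
    · rw [Matrix.mul_apply, Fintype.sum_sum_type]
      rcases i with i | i <;> simp [Matrix.one_apply]
  have h3 := congrArg Matrix.det h2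
  rw [Matrix.det_mul, Matrix.det_fromBlocks_zero₁₂, Matrix.det_fromBlocks_zero₂₁, Matrix.det_one,
    Matrix.det_one, mul_one, one_mul] at h3
  have h4 : (A.submatrix f e).det = (Perm.sign (e.symm.trans f) : ℤ) * A.det := by
    rw [← Matrix.det_permute, ← Matrix.det_submatrix_equiv_self e]
    congr 1
    ext i j
    simp
  have h5 : (Perm.sign (e.symm.trans f) : ℤ) =
      (-1) ^ (∑ i : Fin k, (e (Sum.inl i) : ℕ) + ∑ i : Fin k, (f (Sum.inl i) : ℕ)) := by
    have : e.symm.trans f =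
        (finSumFinEquiv.symm.trans e).symm.trans (finSumFinEquiv.symm.trans f) := by
      ext; simp
    rw [this, Perm.sign_trans, Perm.sign_symm, Units.val_mul, sign_of_strictMono_sum e hel her,
      sign_of_strictMono_sum f hfl hfr, ← pow_add]
    refine neg_one_pow_congr ?_
    rw [Nat.even_add, Nat.even_add, Nat.even_add, Nat.even_add]
    tauto
  rw [h4, h5] at h3
  rw [← h3]
  push_cast
  rw [← mul_assoc, ← mul_assoc, ← pow_add, Even.neg_one_pow ⟨_, rfl⟩, one_mul]

end Jacobi

/-- The Toeplitz matrix of a power series. -/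
noncomputable def toeplitz {R : Type*} [CommRing R] (φ : R⟦X⟧) (i j : ℕ) : R :=
  if j ≤ i then coeff (i - j) φ else 0

theorem toeplitz_of_lt {R : Type*} [CommRing R] (φ : R⟦X⟧) {i j : ℕ} (h : i < j) :
    toeplitz φ i j = 0 := if_neg (by omega)

theorem toeplitz_mul {R : Type*} [CommRing R] (φ ψ : R⟦X⟧) (i j N : ℕ) (hN : i < N) :
    ∑ l ∈ Finset.range N, toeplitz φ i l * toeplitz ψ l j = toeplitz (φ * ψ) i j := by
  rcases lt_or_ge i j with h | h
  · rw [toeplitz_of_lt _ h]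
    refine Finset.sum_eq_zero fun l _ => ?_
    rcases lt_or_ge i l with h' | h'
    · rw [toeplitz_of_lt _ h', zero_mul]
    · rw [toeplitz_of_lt ψ (by omega), mul_zero]
  · rw [toeplitz, if_pos h, mul_comm φ ψ, coeff_mul,
      Finset.Nat.sum_antidiagonal_eq_sum_range_succ_mk]
    symm
    refine Finset.sum_of_injOn (fun x => j + x) (fun x _ y _ h => by simpa using h) ?_ ?_ ?_
    · intro x hx
      simp at hx ⊢
      omega
    · intro l _ hl
      simp only [Finset.coe_range, Set.mem_image, Set.mem_Iio, not_exists, not_and] at hl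
      rcases lt_or_ge i l with h' | h'
      · rw [toeplitz_of_lt _ h', zero_mul]
      · rcases lt_or_ge l j with h2 | h2
        · rw [toeplitz_of_lt ψ h2, mul_zero]
        · exact absurd (by omega) (hl (l - j) (by omega))
    · intro x hx
      simp only [Finset.mem_range] at hx
      rw [toeplitz, toeplitz, if_pos (by omega), if_pos (by omega), mul_comm]
      congr 3 <;> omega

theorem toeplitz_one {R : Type*} [CommRing R] (i j : ℕ) :
    toeplitz (1 : R⟦X⟧) i j = if i = j then 1 else 0 := by
  rw [toeplitz, coeff_one]
  by_cases h : i = j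
  · simp [h]
  · by_cases h' : j ≤ i
    · rw [if_pos h', if_neg (by omega), if_neg h]
    · rw [if_neg h', if_neg h]

/-- If `φ` is PF then so is `1 / φ(-t)`. -/
theorem TP.toeplitz_inverse {φ ψ : ℝ⟦X⟧} (h : TP (Subsemiring.nonneg ℝ) (toeplitz φ))
    (hφψ : φ * ψ = 1) :
    TP (Subsemiring.nonneg ℝ) fun i j => (-1) ^ (i - j) * toeplitz ψ i j := by
  have hφ0 : 0 < coeff 0 φ := by
    have h1 : 0 ≤ toeplitz φ 0 0 := h.apply_mem 0 0
    have h2 : coeff 0 φ * coeff 0 ψ = 1 := by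
      have := congrArg (coeff 0) hφψ
      simpa using this
    simp only [toeplitz, le_refl, if_true, Nat.sub_zero] at h1
    exact lt_of_le_of_ne h1 fun h0 => by simp [← h0] at h2
  intro k r c hr hc
  rw [Subsemiring.mem_nonneg]
  -- Lower triangularity makes truncations of the two Toeplitz matrices mutually inverse, so any
  -- size containing all the chosen rows and columns works.
  set m := ∑ i, r i + ∑ i, c i + 1 with hm
  have hrm : ∀ i, r i < k + m := fun i => by
    have := Finset.single_le_sum (f := r) (fun _ _ => Nat.zero_le _) (Finset.mem_univ i)
    omega
  have hcm : ∀ i, c i < k + m := fun i => by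
    have := Finset.single_le_sum (f := c) (fun _ _ => Nat.zero_le _) (Finset.mem_univ i)
    omega
  set A : Matrix (Fin (k + m)) (Fin (k + m)) ℝ := Matrix.of fun i j => toeplitz φ i j with hA
  set B : Matrix (Fin (k + m)) (Fin (k + m)) ℝ := Matrix.of fun i j => toeplitz ψ i j with hB
  have hAB : A * B = 1 := by
    ext i j
    rw [Matrix.mul_apply, Matrix.one_apply]
    simp only [hA, hB, Matrix.of_apply]
    rw [← Finset.sum_range (f := fun l => toeplitz φ i l * toeplitz ψ l j),
      toeplitz_mul φ ψ i j _ i.2, hφψ, toeplitz_one]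
    simp [Fin.ext_iff]
  have hdet : 0 < A.det := by
    rw [Matrix.det_of_isLowerTriangular A fun i j hij => toeplitz_of_lt φ hij]
    refine Finset.prod_pos fun i _ => ?_
    simpa [hA, toeplitz] using hφ0
  have build : ∀ s : Fin k → ℕ, StrictMono s → (∀ i, s i < k + m) →
      ∃ e : Fin k ⊕ Fin m ≃ Fin (k + m), (∀ i, (e (Sum.inl i) : ℕ) = s i) ∧
        StrictMono (e ∘ Sum.inl) ∧ StrictMono (e ∘ Sum.inr) := by
    intro s hs hsm
    let s' : Fin k → Fin (k + m) := fun i => ⟨s i, hsm i⟩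
    have hs' : StrictMono s' := fun i j hij => hs hij
    have hcard : (Finset.univ.image s').card = k := by
      rw [Finset.card_image_of_injective _ hs'.injective]; simp
    have hcard' : (Finset.univ.image s')ᶜ.card = m := by
      rw [Finset.card_compl, hcard]; simp
    refine ⟨finSumEquivOfFinset hcard hcard', fun i => ?_, fun i j hij => ?_, fun i j hij => ?_⟩
    · have := Finset.orderEmbOfFin_unique hcard (fun x => by simp) hs'
      rw [finSumEquivOfFinset_inl, ← this]
    · simpa using hij
    · simpa using hij
  obtain ⟨e, he, hel, her⟩ := build r hr hrm
  obtain ⟨f, hf, hfl, hfr⟩ := build c hc hcm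
  have key := det_submatrix_inverse hAB e f hel her hfl hfr
  have hBsub : B.submatrix (e ∘ Sum.inl) (f ∘ Sum.inl) =
      Matrix.of fun i j => toeplitz ψ (r i) (c j) := by
    ext i j
    simp [hB, he, hf]
  rw [hBsub] at key
  -- The alternating signs contribute exactly the sign in Jacobi's formula, so the two cancel.
  have hscale : (Matrix.of fun i j => (-1) ^ (r i - c j) * toeplitz ψ (r i) (c j)).det =
      (-1) ^ (∑ i, r i + ∑ i, c i) * (Matrix.of fun i j => toeplitz ψ (r i) (c j)).det := by
    have h1 := Matrix.det_mul_column (fun i => (-1 : ℝ) ^ (r i))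
      (Matrix.of fun i j => (-1 : ℝ) ^ (c j) * toeplitz ψ (r i) (c j))
    have h2 := Matrix.det_mul_row (fun i => (-1 : ℝ) ^ (c i))
      (Matrix.of fun i j => toeplitz ψ (r i) (c j))
    have : (Matrix.of fun i j => (-1) ^ (r i - c j) * toeplitz ψ (r i) (c j)) =
        Matrix.of fun i j => (-1 : ℝ) ^ r i *
          (Matrix.of fun i j => (-1 : ℝ) ^ (c j) * toeplitz ψ (r i) (c j)) i j := by
      ext i j
      simp only [Matrix.of_apply]
      rcases lt_or_ge (r i) (c j) with h' | h'
      · simp [toeplitz_of_lt _ h']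
      · rw [← mul_assoc, ← pow_add]
        congr 1
        refine neg_one_pow_congr ?_
        rw [Nat.even_sub h', Nat.even_add]
    rw [this, h1]
    simp only [Matrix.of_apply] at h2 ⊢
    rw [h2, Finset.prod_pow_eq_pow_sum, Finset.prod_pow_eq_pow_sum, pow_add, mul_assoc]
  rw [hscale]
  refine nonneg_of_mul_nonneg_right ?_ hdet
  have hA' : 0 ≤ (A.submatrix (f ∘ Sum.inr) (e ∘ Sum.inr)).det :=
    h m (fun i => f (Sum.inr i)) (fun i => e (Sum.inr i)) (fun i j hij => hfr hij)
      (fun i j hij => her hij)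
  rw [mul_left_comm, key]
  simp_rw [he, hf]
  rw [← mul_assoc, ← pow_add, Even.neg_one_pow ⟨_, rfl⟩, one_mul]
  exact hA'

/-! ### The Stieltjes moment problem -/

section Stieltjes

open MeasureTheory Filter Topology
open scoped NNReal ENNReal CompactlySupported

theorem eval_nonneg_of_forall_gt {r : Polynomial ℝ} {a : ℝ} (h : ∀ x > a, 0 ≤ r.eval x) :
    0 ≤ r.eval a := by
  have h1 : Tendsto (fun x => r.eval x) (𝓝[>] a) (𝓝 (r.eval a)) :=
    r.continuous.continuousAt.mono_left nhdsWithin_le_nhds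
  exact ge_of_tendsto h1 (eventually_nhdsWithin_of_forall h)

theorem eval_nonpos_of_forall_lt {r : Polynomial ℝ} {a : ℝ} (ha : 0 < a)
    (h : ∀ x, 0 ≤ x → x < a → r.eval x ≤ 0) : r.eval a ≤ 0 := by
  have h1 : Tendsto (fun x => r.eval x) (𝓝[<] a) (𝓝 (r.eval a)) :=
    r.continuous.continuousAt.mono_left nhdsWithin_le_nhds
  refine le_of_tendsto h1 ?_
  filter_upwards [self_mem_nhdsWithin, mem_nhdsWithin_of_mem_nhds (lt_mem_nhds ha)] with x h2 h3
  exact h x h3.le h2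

/-- A nonnegative nonconstant polynomial attains its minimum on `[0, ∞)`. -/
theorem exists_min_eval {p : Polynomial ℝ} (hp : ∀ x, 0 ≤ x → 0 ≤ p.eval x)
    (hd : 0 < p.natDegree) : ∃ a, 0 ≤ a ∧ ∀ x, 0 ≤ x → p.eval a ≤ p.eval x := by
  have hd' : 0 < p.degree := Polynomial.natDegree_pos_iff_degree_pos.1 hd
  have h1 : Tendsto (fun x => |p.eval x|) atTop atTop := p.abs_tendsto_atTop hd'
  obtain ⟨K, hK⟩ := (eventually_atTop.1 (h1.eventually_ge_atTop (p.eval 0)))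
  obtain ⟨a, ha, hmin⟩ := (isCompact_Icc (a := (0 : ℝ)) (b := max K 0)).exists_isMinOn
    ⟨0, by simp⟩ p.continuous.continuousOn
  refine ⟨a, ha.1, fun x hx => ?_⟩
  rcases le_total x (max K 0) with h | h
  · exact hmin ⟨hx, h⟩
  · have h2 := hK x (le_trans (le_max_left _ _) h)
    rw [abs_of_nonneg (hp x hx)] at h2
    exact le_trans (hmin ⟨le_rfl, le_max_right _ _⟩) h2

/-- A linear functional which is nonnegative on `s ^ 2` and `X * s ^ 2` is nonnegative on the
polynomials that are nonnegative on `[0, ∞)`. -/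
theorem map_nonneg_of_sq_nonneg (p : Polynomial ℝ) (hp : ∀ x, 0 ≤ x → 0 ≤ p.eval x)
    (L : Polynomial ℝ →ₗ[ℝ] ℝ) (h1 : ∀ s, 0 ≤ L (s ^ 2)) (h2 : ∀ s, 0 ≤ L (Polynomial.X * s ^ 2)) :
    0 ≤ L p := by
  induction hn : p.natDegree using Nat.strong_induction_on generalizing p L with
  | _ n ih =>
  have hC : ∀ c : ℝ, 0 ≤ c → 0 ≤ L (Polynomial.C c) := fun c hc => by
    have := h1 (Polynomial.C (Real.sqrt c))
    rwa [← Polynomial.C_pow, Real.sq_sqrt hc] at this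
  rcases Nat.eq_zero_or_pos p.natDegree with h0 | hpos
  · rw [Polynomial.eq_C_of_natDegree_eq_zero h0]
    refine hC _ ?_
    have := hp 0 le_rfl
    rwa [← Polynomial.coeff_zero_eq_eval_zero] at this
  -- Splitting off the minimum value leaves a nonnegative polynomial with a root `a`, which is then
  -- divided out.
  obtain ⟨a, ha, hmin⟩ := exists_min_eval hp hpos
  have hroot : (p - Polynomial.C (p.eval a)).IsRoot a := by simp
  obtain ⟨r, hr⟩ := Polynomial.dvd_iff_isRoot.2 hroot
  have hpr : p = Polynomial.C (p.eval a) + (Polynomial.X - Polynomial.C a) * r := by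
    rw [← hr]; ring
  have hdeg : (p - Polynomial.C (p.eval a)).natDegree = p.natDegree :=
    Polynomial.natDegree_sub_C
  have hr0 : r ≠ 0 := by
    rintro rfl
    rw [hr] at hdeg
    simp at hdeg
    omega
  have hrdeg : r.natDegree + 1 = n := by
    rw [hr, Polynomial.natDegree_mul (Polynomial.X_sub_C_ne_zero a) hr0,
      Polynomial.natDegree_X_sub_C] at hdeg
    omega
  have hev : ∀ x, 0 ≤ x → 0 ≤ (x - a) * r.eval x := fun x hx => by
    have := hmin x hx
    have e := congrArg (Polynomial.eval x) hr
    simp only [Polynomial.eval_sub, Polynomial.eval_C, Polynomial.eval_mul, Polynomial.eval_X] at e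
    linarith
  rw [hpr, map_add]
  refine add_nonneg (hC _ (hp a ha)) ?_
  have hgt : ∀ x > a, 0 ≤ r.eval x := fun x hx =>
    nonneg_of_mul_nonneg_right (hev x (ha.trans hx.le)) (sub_pos.2 hx)
  -- For a minimum at the endpoint, one factor `X` is removed, and passing to `L(X ·)` exchanges the
  -- two hypotheses on squares. For an interior minimum, `r` changes sign at `a`, so `(X - a)^2`
  -- divides out and is absorbed in the squares.
  rcases ha.eq_or_lt with rfl | hapos
  · rw [Polynomial.C_0, sub_zero]
    refine ih _ (by omega) r (fun x hx => ?_) (L.comp (LinearMap.mulLeft ℝ Polynomial.X)) ?_ ?_ rfl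
    · rcases hx.eq_or_lt with rfl | hx'
      · exact eval_nonneg_of_forall_gt hgt
      · exact hgt x hx'
    · exact fun s => h2 s
    · intro s
      have := h1 (Polynomial.X * s)
      simp only [LinearMap.comp_apply, LinearMap.mulLeft_apply]
      convert this using 2
      ring
  · have hra : r.eval a = 0 := le_antisymm
      (eval_nonpos_of_forall_lt hapos fun x hx hxa => by
        have := hev x hx
        by_contra hcon
        push Not at hcon
        nlinarith) (eval_nonneg_of_forall_gt hgt)
    obtain ⟨r₂, hr₂⟩ := Polynomial.dvd_iff_isRoot.2 (show r.IsRoot a from hra)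
    have hr₂0 : r₂ ≠ 0 := by
      rintro rfl
      exact hr0 (by simpa using hr₂)
    have hr₂deg : r₂.natDegree + 2 = n := by
      have := Polynomial.natDegree_mul (Polynomial.X_sub_C_ne_zero a) hr₂0
      rw [← hr₂, Polynomial.natDegree_X_sub_C] at this
      omega
    have hne : ∀ x, 0 ≤ x → x ≠ a → 0 ≤ r₂.eval x := fun x hx hxa => by
      have := hev x hx
      rw [hr₂, Polynomial.eval_mul, Polynomial.eval_sub, Polynomial.eval_X, Polynomial.eval_C,
        ← mul_assoc] at this
      exact nonneg_of_mul_nonneg_right this (mul_self_pos.2 (sub_ne_zero.2 hxa))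
    have := ih _ (by omega) r₂ (fun x hx => ?_)
      (L.comp (LinearMap.mulLeft ℝ ((Polynomial.X - Polynomial.C a) ^ 2))) ?_ ?_ rfl
    · simp only [LinearMap.comp_apply, LinearMap.mulLeft_apply] at this
      rwa [hr₂, ← mul_assoc, ← pow_two]
    · rcases eq_or_ne x a with rfl | hxa
      · exact eval_nonneg_of_forall_gt fun y hy => hne y (hx.trans (le_of_lt hy)) (ne_of_gt hy)
      · exact hne x hx hxa
    · intro s
      have := h1 ((Polynomial.X - Polynomial.C a) * s)
      simp only [LinearMap.comp_apply, LinearMap.mulLeft_apply]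
      rwa [← mul_pow]
    · intro s
      have := h2 ((Polynomial.X - Polynomial.C a) * s)
      simp only [LinearMap.comp_apply, LinearMap.mulLeft_apply]
      convert this using 2
      ring

/-- A nonnegative functional on the polynomials extends to pairs of a polynomial and a compactly
supported function on `[0, ∞)`. -/
theorem exists_extension_compactlySupported (L : Polynomial ℝ →ₗ[ℝ] ℝ)
    (hL : ∀ p : Polynomial ℝ, (∀ x, 0 ≤ x → 0 ≤ p.eval x) → 0 ≤ L p) :
    ∃ g : (Polynomial ℝ × C_c(ℝ≥0, ℝ)) →ₗ[ℝ] ℝ, (∀ p, g (p, 0) = L p) ∧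
      ∀ p h, (∀ x : ℝ≥0, 0 ≤ p.eval (x : ℝ) + h x) → 0 ≤ g (p, h) := by
  let s : PointedCone ℝ (Polynomial ℝ × C_c(ℝ≥0, ℝ)) :=
    { carrier := {u | ∀ x : ℝ≥0, 0 ≤ u.1.eval (x : ℝ) + u.2 x}
      zero_mem' := by simp
      smul_mem' := fun c u hu x => by
        have h1 : 0 ≤ (c : ℝ) * (u.1.eval (x : ℝ) + u.2 x) := mul_nonneg c.2 (hu x)
        have h2 : (c • u).1.eval (x : ℝ) + (c • u).2 x =
            (c : ℝ) * (u.1.eval (x : ℝ) + u.2 x) := by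
          have e1 : (c • u).1 = (c : ℝ) • u.1 := rfl
          have e2 : (c • u).2 x = (c : ℝ) * u.2 x := rfl
          rw [e1, e2, Polynomial.eval_smul, smul_eq_mul, mul_add]
        rw [h2]; exact h1
      add_mem' := fun {u v} hu hv x => by
        have h1 := hu x
        have h2 := hv x
        simp only [Prod.fst_add, Prod.snd_add, Polynomial.eval_add,
          CompactlySupportedContinuousMap.add_apply]
        linarith }
  let D : Submodule ℝ (Polynomial ℝ × C_c(ℝ≥0, ℝ)) :=
    LinearMap.ker (LinearMap.snd ℝ (Polynomial ℝ) C_c(ℝ≥0, ℝ))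
  let f : (Polynomial ℝ × C_c(ℝ≥0, ℝ)) →ₗ.[ℝ] ℝ :=
    ⟨D, (L.comp (LinearMap.fst ℝ (Polynomial ℝ) C_c(ℝ≥0, ℝ))).domRestrict D⟩
  have hmem : ∀ p, (p, (0 : C_c(ℝ≥0, ℝ))) ∈ D := fun p => by simp [D]
  obtain ⟨g, hg1, hg2⟩ := riesz_extension s f
    (by
      rintro ⟨⟨p, h⟩, hph⟩ hs
      have h0 : h = 0 := hph
      subst h0
      refine hL p fun x hx => ?_
      have := hs ⟨x, hx⟩
      exact this.trans_eq (add_zero _))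
    (by
      rintro ⟨p, h⟩
      -- The extension theorem needs every pair to be dominated from the polynomial side; a constant
      -- bounding `|h|` suffices.
      obtain ⟨K, hK⟩ := h.continuous.bounded_above_of_compact_support h.hasCompactSupport
      refine ⟨⟨(-p + Polynomial.C K, 0), hmem _⟩, fun x => ?_⟩
      have h1 : |h x| ≤ K := hK x
      have := neg_abs_le (h x)
      simp
      linarith)
  exact ⟨g, fun p => hg1 ⟨(p, 0), hmem p⟩, fun p h hph => hg2 (p, h) hph⟩

/-- The continuous cutoff equal to `1` on `[0, n]` and to `0` on `[n + 1, ∞)`. -/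
noncomputable def cutoff (n : ℕ) (x : ℝ≥0) : ℝ := max 0 (min 1 (n + 1 - x))

theorem cutoff_nonneg (n : ℕ) (x : ℝ≥0) : 0 ≤ cutoff n x := le_max_left _ _

theorem cutoff_le_one (n : ℕ) (x : ℝ≥0) : cutoff n x ≤ 1 :=
  max_le zero_le_one (min_le_left _ _)

theorem cutoff_eq_one {n : ℕ} {x : ℝ≥0} (h : (x : ℝ) ≤ n) : cutoff n x = 1 := by
  rw [cutoff, min_eq_left (by linarith), max_eq_right zero_le_one]

theorem cutoff_mono (x : ℝ≥0) : Monotone fun n => cutoff n x := fun m n hmn => by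
  have : (m : ℝ) ≤ n := by exact_mod_cast hmn
  exact max_le_max le_rfl (min_le_min le_rfl (by linarith))

/-- The compactly supported function `x ^ k` times a cutoff. -/
noncomputable def cutoffPow (k n : ℕ) : C_c(ℝ≥0, ℝ) where
  toFun x := (x : ℝ) ^ k * cutoff n x
  continuous_toFun := by unfold cutoff; fun_prop
  hasCompactSupport' := by
    refine HasCompactSupport.of_support_subset_isCompact
      (isCompact_Icc (a := (0 : ℝ≥0)) (b := (n + 1 : ℝ≥0))) fun x hx => ⟨zero_le, ?_⟩
    by_contra hcon
    push Not at hcon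
    refine hx ?_
    have h' : ((n + 1 : ℝ≥0) : ℝ) < x := by exact_mod_cast hcon
    push_cast at h'
    simp only [cutoff]
    rw [max_eq_left ((min_le_right _ _).trans (by linarith)), mul_zero]

/-- **Haviland's theorem** on `[0, ∞)`. -/
theorem isSM_of_map_nonneg (L : Polynomial ℝ →ₗ[ℝ] ℝ)
    (hL : ∀ p : Polynomial ℝ, (∀ x, 0 ≤ x → 0 ≤ p.eval x) → 0 ≤ L p) :
    IsSM fun n => L (Polynomial.X ^ n) := by
  obtain ⟨g, hg, hpos⟩ := exists_extension_compactlySupported L hL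
  let Λ : C_c(ℝ≥0, ℝ) →ₚ[ℝ] ℝ := PositiveLinearMap.mk₀ (g.comp (LinearMap.inr ℝ _ _))
    fun h hh => hpos 0 h fun x => by simpa using hh x
  have hΛ : ∀ h, Λ h = g (0, h) := fun h => rfl
  set μ : Measure ℝ≥0 := RealRMK.rieszMeasure Λ with hμ
  have hXnonneg : ∀ k, 0 ≤ L (Polynomial.X ^ k) := fun k =>
    hL _ fun x hx => by simpa using pow_nonneg hx k
  have hle : ∀ k n, Λ (cutoffPow k n) ≤ L (Polynomial.X ^ k) := fun k n => by
    have h1 := hpos (Polynomial.X ^ k) (-cutoffPow k n) fun x => by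
      have h2 : (cutoffPow k n) x = (x : ℝ) ^ k * cutoff n x := rfl
      have h3 : (-cutoffPow k n) x = -((x : ℝ) ^ k * cutoff n x) := by rw [← h2]; rfl
      rw [h3]
      simp only [Polynomial.eval_pow, Polynomial.eval_X]
      have h5 : 0 ≤ (x : ℝ) ^ k := pow_nonneg x.2 k
      nlinarith [cutoff_le_one n x]
    have h4 : ((Polynomial.X ^ k : Polynomial ℝ), -cutoffPow k n) =
        (Polynomial.X ^ k, (0 : C_c(ℝ≥0, ℝ))) - (0, cutoffPow k n) := by simp
    rw [h4, map_sub, hg] at h1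
    rw [hΛ]; linarith
  -- No mass escapes to infinity: the part of `x^k` removed by the cutoff lives on `x ≥ n`, where
  -- `x^k ≤ x^(k+1) / n`.
  have hge : ∀ k n, 0 < n → L (Polynomial.X ^ k) - L (Polynomial.X ^ (k + 1)) / n ≤
      Λ (cutoffPow k n) := fun k n hn => by
    have hn' : (0 : ℝ) < n := by exact_mod_cast hn
    have h1 := hpos ((n : ℝ)⁻¹ • Polynomial.X ^ (k + 1) - Polynomial.X ^ k) (cutoffPow k n)
      fun x => by
        have h2 : (cutoffPow k n) x = (x : ℝ) ^ k * cutoff n x := rfl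
        rw [h2]
        simp only [Polynomial.eval_pow, Polynomial.eval_X, Polynomial.eval_sub,
          Polynomial.eval_smul, smul_eq_mul]
        have hx : 0 ≤ (x : ℝ) ^ k := pow_nonneg x.2 k
        rcases le_total (x : ℝ) n with h | h
        · rw [cutoff_eq_one h]
          have : 0 ≤ (n : ℝ)⁻¹ * (x : ℝ) ^ (k + 1) := by positivity
          linarith
        · have h5 : 1 ≤ (n : ℝ)⁻¹ * x := by
            rw [inv_mul_eq_div, le_div_iff₀ hn']; linarith
          have h6 : (n : ℝ)⁻¹ * (x : ℝ) ^ (k + 1) = ((n : ℝ)⁻¹ * x) * (x : ℝ) ^ k := by ring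
          rw [h6]
          nlinarith [cutoff_nonneg n x, mul_nonneg hx (cutoff_nonneg n x)]
    have h4 : ∀ p : Polynomial ℝ, (p, cutoffPow k n) =
        (p, (0 : C_c(ℝ≥0, ℝ))) + (0, cutoffPow k n) := fun p => by simp
    rw [h4, map_add, hg, map_sub, map_smul, smul_eq_mul, inv_mul_eq_div] at h1
    rw [hΛ]; linarith
  have hlim : ∀ k, Tendsto (fun n => Λ (cutoffPow k n)) atTop (𝓝 (L (Polynomial.X ^ k))) := by
    intro k
    have h1 : Tendsto (fun n : ℕ => L (Polynomial.X ^ k) - L (Polynomial.X ^ (k + 1)) / n) atTop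
        (𝓝 (L (Polynomial.X ^ k) - 0)) :=
      tendsto_const_nhds.sub (tendsto_const_div_atTop_nhds_zero_nat _)
    rw [sub_zero] at h1
    refine tendsto_of_tendsto_of_tendsto_of_le_of_le' h1 tendsto_const_nhds ?_
      (Eventually.of_forall (hle k))
    filter_upwards [eventually_gt_atTop 0] with n hn using hge k n hn
  have hlint : ∀ k : ℕ, ∫⁻ x : ℝ≥0, ENNReal.ofReal ((x : ℝ) ^ k) ∂μ =
      ENNReal.ofReal (L (Polynomial.X ^ k)) := by
    intro k
    have h1 : Tendsto (fun n => ∫⁻ x : ℝ≥0, ENNReal.ofReal (cutoffPow k n x) ∂μ) atTop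
        (𝓝 (∫⁻ x : ℝ≥0, ENNReal.ofReal ((x : ℝ) ^ k) ∂μ)) := by
      refine lintegral_tendsto_of_tendsto_of_monotone ?_ ?_ ?_
      · exact fun n => ((cutoffPow k n).continuous.measurable.ennreal_ofReal).aemeasurable
      · refine Eventually.of_forall fun x m n hmn => ENNReal.ofReal_le_ofReal ?_
        exact mul_le_mul_of_nonneg_left (cutoff_mono x hmn) (pow_nonneg x.2 k)
      · refine Eventually.of_forall fun x => tendsto_const_nhds.congr' ?_
        obtain ⟨N, hN⟩ := exists_nat_ge (x : ℝ)
        filter_upwards [eventually_ge_atTop N] with n hn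
        have h2 : (cutoffPow k n) x = (x : ℝ) ^ k * cutoff n x := rfl
        rw [h2, cutoff_eq_one (hN.trans (by exact_mod_cast hn)), mul_one]
    have h2 : ∀ n, ∫⁻ x : ℝ≥0, ENNReal.ofReal (cutoffPow k n x) ∂μ =
        ENNReal.ofReal (Λ (cutoffPow k n)) := fun n => by
      rw [← RealRMK.integral_rieszMeasure Λ, ofReal_integral_eq_lintegral_ofReal]
      · exact (cutoffPow k n).continuous.integrable_of_hasCompactSupport
          (cutoffPow k n).hasCompactSupport
      · exact Eventually.of_forall fun x => mul_nonneg (pow_nonneg x.2 k) (cutoff_nonneg n x)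
    simp_rw [h2] at h1
    exact tendsto_nhds_unique h1 (ENNReal.tendsto_ofReal (hlim k))
  have hmeas : ∀ k : ℕ, Measurable fun x : ℝ≥0 => (x : ℝ) ^ k := fun k => by fun_prop
  have hint : ∀ k : ℕ, Integrable (fun x : ℝ≥0 => (x : ℝ) ^ k) μ := fun k =>
    ⟨(hmeas k).aestronglyMeasurable, by
      rw [hasFiniteIntegral_iff_ofReal (Eventually.of_forall fun x => pow_nonneg x.2 k), hlint]
      exact ENNReal.ofReal_lt_top⟩
  have hcoe : Measurable ((↑) : ℝ≥0 → ℝ) := measurable_coe_nnreal_real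
  refine ⟨μ.map (↑), ?_, fun k => ⟨?_, ?_⟩⟩
  · rw [Measure.map_apply hcoe measurableSet_Iio]
    convert measure_empty (μ := μ)
    ext x
    simp
  · exact (integrable_map_measure (by fun_prop) hcoe.aemeasurable).2 (hint k)
  · rw [integral_map hcoe.aemeasurable (by fun_prop),
      integral_eq_lintegral_of_nonneg_ae (Eventually.of_forall fun x => pow_nonneg x.2 k)
        (hmeas k).aestronglyMeasurable, hlint, ENNReal.toReal_ofReal (hXnonneg k)]

/-- The linear functional on polynomials with moments `a`. -/
noncomputable def momentMap (a : ℕ → ℝ) : Polynomial ℝ →ₗ[ℝ] ℝ :=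
  (Polynomial.basisMonomials ℝ).constr ℝ a

theorem momentMap_X_pow (a : ℕ → ℝ) (n : ℕ) : momentMap a (Polynomial.X ^ n) = a n := by
  have := (Polynomial.basisMonomials ℝ).constr_basis ℝ a n
  rw [Polynomial.coe_basisMonomials] at this
  rw [← Polynomial.monomial_one_right_eq_X_pow]
  exact this

theorem momentMap_eq_sum (a : ℕ → ℝ) (p : Polynomial ℝ) {N : ℕ} (hN : p.natDegree < N) :
    momentMap a p = ∑ k ∈ Finset.range N, p.coeff k * a k := by
  conv_lhs => rw [p.as_sum_range' N hN]
  rw [map_sum]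
  refine Finset.sum_congr rfl fun k _ => ?_
  rw [← Polynomial.smul_X_eq_monomial, map_smul, momentMap_X_pow, smul_eq_mul]

theorem momentMap_of_isSM {a : ℕ → ℝ} (h : IsSM a) {p : Polynomial ℝ}
    (hp : ∀ x, 0 ≤ x → 0 ≤ p.eval x) : 0 ≤ momentMap a p := by
  obtain ⟨μ, h0, hμ⟩ := h
  have : momentMap a p = ∫ x, p.eval x ∂μ := by
    rw [momentMap_eq_sum a p (Nat.lt_succ_self _)]
    simp_rw [Polynomial.eval_eq_sum_range]
    rw [integral_finsetSum _ fun k _ => (hμ k).1.const_mul _]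
    refine Finset.sum_congr rfl fun k _ => ?_
    rw [integral_const_mul, (hμ k).2]
  rw [this]
  refine integral_nonneg_of_ae ?_
  have h0' : ∀ᵐ x ∂μ, x ∉ Set.Iio (0 : ℝ) := measure_eq_zero_iff_ae_notMem.1 h0
  filter_upwards [h0'] with x hx
  exact hp x (not_lt.1 hx)

theorem isSM_of_momentMap {a : ℕ → ℝ} (h1 : ∀ s, 0 ≤ momentMap a (s ^ 2))
    (h2 : ∀ s, 0 ≤ momentMap a (Polynomial.X * s ^ 2)) : IsSM a := by
  have := isSM_of_map_nonneg (momentMap a) fun p hp => map_nonneg_of_sq_nonneg p hp _ h1 h2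
  simpa only [momentMap_X_pow] using this

/-- A symmetric real matrix with nonnegative principal minors is positive semidefinite. -/
theorem posSemidef_of_minors {n : Type*} [Fintype n] [DecidableEq n] {A : Matrix n n ℝ}
    (hA : A.IsHermitian)
    (h : ∀ s : Finset n, 0 ≤ (A.submatrix (Subtype.val : s → n) (Subtype.val : s → n)).det) :
    A.PosSemidef := by
  rw [hA.posSemidef_iff_eigenvalues_nonneg]
  intro i
  by_contra hcon
  simp only [Pi.zero_apply, not_le] at hcon
  have hroot : A.charpoly.IsRoot (hA.eigenvalues i) :=
    Matrix.mem_spectrum_iff_isRoot_charpoly.1 (hA.eigenvalues_mem_spectrum_real i)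
  set x := hA.eigenvalues i with hx
  have hdeg : A.charpoly.natDegree = Fintype.card n := A.charpoly_natDegree_eq_dim
  rw [Polynomial.IsRoot.def, Polynomial.eval_eq_sum_range, hdeg,
    ← Finset.sum_range_reflect] at hroot
  -- The coefficients of the characteristic polynomial are signed sums of principal minors. At a
  -- negative `x` all terms therefore have the same sign, and the leading one is nonzero, so `x`
  -- cannot be a root.
  have hterm : ∀ k ∈ Finset.range (Fintype.card n + 1),
      A.charpoly.coeff (Fintype.card n + 1 - 1 - k) * x ^ (Fintype.card n + 1 - 1 - k) =
      (-1) ^ Fintype.card n * ((∑ s ∈ Finset.univ.powersetCard k,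
        (A.submatrix (Subtype.val : s → n) (Subtype.val : s → n)).det) *
          (-x) ^ (Fintype.card n - k)) := by
    intro k hk
    have hk' : k ≤ Fintype.card n := by simpa [Nat.lt_succ_iff] using hk
    rw [Nat.add_sub_cancel, Matrix.charpoly_coeff_eq_sum_minors A k hk',
      show (-1 : ℝ) ^ Fintype.card n = (-1) ^ k * (-1) ^ (Fintype.card n - k) by
        rw [← pow_add, Nat.add_sub_cancel' hk'], neg_pow x]
    have : ((-1 : ℝ) ^ (Fintype.card n - k)) * (-1) ^ (Fintype.card n - k) = 1 := by
      rw [← pow_add, Even.neg_one_pow ⟨_, rfl⟩]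
    linear_combination (-((-1) ^ k * (∑ s ∈ Finset.univ.powersetCard k,
        (A.submatrix (Subtype.val : s → n) (Subtype.val : s → n)).det) *
          x ^ (Fintype.card n - k))) * this
  rw [Finset.sum_congr rfl hterm, ← Finset.mul_sum] at hroot
  have hx' : 0 < -x := by linarith
  have hpos : 0 < ∑ k ∈ Finset.range (Fintype.card n + 1), (∑ s ∈ Finset.univ.powersetCard k,
        (A.submatrix (Subtype.val : s → n) (Subtype.val : s → n)).det) *
          (-x) ^ (Fintype.card n - k) := by
    rw [Finset.sum_range_succ']
    refine add_pos_of_nonneg_of_pos (Finset.sum_nonneg fun k _ => mul_nonneg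
      (Finset.sum_nonneg fun s _ => h s) (pow_nonneg hx'.le _)) ?_
    simpa using pow_pos hx' _
  rcases mul_eq_zero.1 hroot with h' | h'
  · exact absurd h' (pow_ne_zero _ (by norm_num))
  · exact hpos.ne' h'

theorem TP.sq_nonneg_sum {M : ℕ → ℕ → ℝ} (h : TP (Subsemiring.nonneg ℝ) M)
    (hs : ∀ i j, M i j = M j i) (n : ℕ) (v : ℕ → ℝ) :
    0 ≤ ∑ i ∈ Finset.range n, ∑ j ∈ Finset.range n, v i * v j * M i j := by
  have hP : (Matrix.of fun i j : Fin n => M i j).PosSemidef := by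
    refine posSemidef_of_minors (by ext i j; simp [hs]) fun s => ?_
    have := h s.card (fun i => s.orderEmbOfFin rfl i) (fun i => s.orderEmbOfFin rfl i)
      (fun i j hij => by simpa using hij) (fun i j hij => by simpa using hij)
    rw [← Matrix.det_submatrix_equiv_self (s.orderIsoOfFin rfl).toEquiv]
    exact this
  have h1 := hP.dotProduct_mulVec_nonneg fun i => v i
  simp only [dotProduct, Matrix.mulVec, star_trivial, Matrix.of_apply, Finset.mul_sum] at h1
  rw [Finset.sum_range]
  refine h1.trans_eq (Finset.sum_congr rfl fun i _ => ?_)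
  rw [Finset.sum_range]
  exact Finset.sum_congr rfl fun j _ => by ring

theorem momentMap_sq (a : ℕ → ℝ) (b : ℕ) (s : Polynomial ℝ) :
    momentMap a (Polynomial.X ^ b * s ^ 2) = ∑ i ∈ Finset.range (s.natDegree + 1),
      ∑ j ∈ Finset.range (s.natDegree + 1), s.coeff i * s.coeff j * a (b + i + j) := by
  conv_lhs => rw [pow_two, s.as_sum_range_C_mul_X_pow, Finset.sum_mul_sum, Finset.mul_sum, map_sum]
  refine Finset.sum_congr rfl fun i _ => ?_
  rw [Finset.mul_sum, map_sum]
  refine Finset.sum_congr rfl fun j _ => ?_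
  rw [← momentMap_X_pow a, ← smul_eq_mul (s.coeff i * s.coeff j), ← map_smul,
    Polynomial.smul_eq_C_mul, Polynomial.C_mul]
  congr 1
  ring

/-- **Stieltjes' theorem**: a sequence whose Hankel matrix is totally positive is a Stieltjes
moment sequence. -/
theorem TP.isSM {a : ℕ → ℝ} (h : TP (Subsemiring.nonneg ℝ) fun i j => a (i + j)) : IsSM a := by
  refine isSM_of_momentMap (fun s => ?_) fun s => ?_
  · have := momentMap_sq a 0 s
    rw [pow_zero, one_mul] at this
    rw [this]
    simp only [zero_add]
    exact h.sq_nonneg_sum (fun i j => by rw [add_comm]) _ _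
  · have := momentMap_sq a 1 s
    rw [pow_one] at this
    rw [this]
    have h' : TP (Subsemiring.nonneg ℝ) fun i j => a (1 + i + j) := fun k r c hr hc =>
      h k (fun i => 1 + r i) c (fun i j hij => by simpa using hr hij) hc
    exact h'.sq_nonneg_sum (fun i j => by congr 1; ring) _ _

/-- Integrating against a product measure, it is enough to consider the convolutions of geometric
sequences. -/
theorem convolutionPreservesSM_of_isSM {A : ℕ → ℕ → ℝ}
    (hA : ∀ s t : ℝ, 0 ≤ s → 0 ≤ t →
      IsSM fun n => ∑ k ∈ Finset.range (n + 1), A n k * s ^ k * t ^ (n - k)) :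
    ConvolutionPreservesSM A := by
  intro x y hx hy
  obtain ⟨μ, hμ0, hμ⟩ := hx
  obtain ⟨ν, hν0, hν⟩ := hy
  have hfin : ∀ ρ : Measure ℝ, Integrable (fun x : ℝ => x ^ 0) ρ → IsFiniteMeasure ρ :=
    fun ρ h => by
      simp only [pow_zero] at h
      exact (integrable_const_iff_isFiniteMeasure one_ne_zero).1 h
  have := hfin μ (hμ 0).1
  have := hfin ν (hν 0).1
  have hint : ∀ n, Integrable (fun z : ℝ × ℝ => ∑ k ∈ Finset.range (n + 1),
      A n k * z.1 ^ k * z.2 ^ (n - k)) (μ.prod ν) := fun n =>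
    integrable_finsetSum _ fun k _ => by
      have := ((hμ k).1.mul_prod (hν (n - k)).1).const_mul (A n k)
      simpa only [mul_assoc] using this
  have hz : ∀ n, ∑ k ∈ Finset.range (n + 1), A n k * x k * y (n - k) =
      ∫ z : ℝ × ℝ, ∑ k ∈ Finset.range (n + 1), A n k * z.1 ^ k * z.2 ^ (n - k) ∂(μ.prod ν) := by
    intro n
    rw [integral_finsetSum _ fun k _ => by
      have := ((hμ k).1.mul_prod (hν (n - k)).1).const_mul (A n k)
      simpa only [mul_assoc] using this]
    refine Finset.sum_congr rfl fun k _ => ?_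
    simp only [mul_assoc]
    rw [integral_const_mul, integral_prod_mul (fun x : ℝ => x ^ k) fun y : ℝ => y ^ (n - k),
      ← (hμ k).2, ← (hν (n - k)).2]
  have hae : ∀ᵐ z : ℝ × ℝ ∂(μ.prod ν), 0 ≤ z.1 ∧ 0 ≤ z.2 := by
    have h1 : ∀ᵐ x ∂μ, 0 ≤ x := by
      filter_upwards [measure_eq_zero_iff_ae_notMem.1 hμ0] with x hx using not_lt.1 hx
    have h2 : ∀ᵐ x ∂ν, 0 ≤ x := by
      filter_upwards [measure_eq_zero_iff_ae_notMem.1 hν0] with x hx using not_lt.1 hx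
    exact (Measure.quasiMeasurePreserving_fst.ae h1).and
      (Measure.quasiMeasurePreserving_snd.ae h2)
  have hL : ∀ p : Polynomial ℝ, (∀ x, 0 ≤ x → 0 ≤ p.eval x) → 0 ≤ momentMap
      (fun n => ∑ k ∈ Finset.range (n + 1), A n k * x k * y (n - k)) p := by
    intro p hp
    have : momentMap (fun n => ∑ k ∈ Finset.range (n + 1), A n k * x k * y (n - k)) p =
        ∫ z : ℝ × ℝ, momentMap (fun n => ∑ k ∈ Finset.range (n + 1),
          A n k * z.1 ^ k * z.2 ^ (n - k)) p ∂(μ.prod ν) := by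
      simp_rw [momentMap_eq_sum _ p (Nat.lt_succ_self _)]
      rw [integral_finsetSum _ fun k _ => (hint k).const_mul _]
      refine Finset.sum_congr rfl fun k _ => ?_
      rw [integral_const_mul, hz]
    rw [this]
    refine integral_nonneg_of_ae ?_
    filter_upwards [hae] with z hz
    exact momentMap_of_isSM (hA z.1 z.2 hz.1 hz.2) hp
  have := isSM_of_map_nonneg _ hL
  simpa only [momentMap_X_pow] using this

theorem IsSM.pow {s : ℝ} (hs : 0 ≤ s) : IsSM fun n => s ^ n := by
  refine ⟨Measure.dirac s, ?_, fun k => ⟨?_, ?_⟩⟩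
  · rw [Measure.dirac_apply' _ measurableSet_Iio]
    simp [hs]
  · exact integrable_dirac (by simp)
  · simp

/-- These are the moments of `s` times a standard exponential variable, by Euler's integral for the
Gamma function. -/
theorem IsSM.factorial_mul_pow {s : ℝ} (hs : 0 ≤ s) :
    IsSM fun n => (n.factorial : ℝ) * s ^ n := by
  have := isSM_of_map_nonneg (momentMap fun n => (n.factorial : ℝ) * s ^ n) fun p hp => ?_
  · simpa only [momentMap_X_pow] using this
  have hint : ∀ k : ℕ, IntegrableOn (fun x : ℝ => Real.exp (-x) * x ^ k) (Set.Ioi 0) := fun k => by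
    have := Real.GammaIntegral_convergent (s := k + 1) (by positivity)
    refine this.congr_fun (fun x hx => ?_) measurableSet_Ioi
    simp
  have hval : ∀ k : ℕ, ∫ x in Set.Ioi (0 : ℝ), Real.exp (-x) * x ^ k = k.factorial := fun k => by
    rw [← Real.Gamma_nat_eq_factorial, Real.Gamma_eq_integral (by positivity)]
    refine setIntegral_congr_fun measurableSet_Ioi fun x hx => ?_
    simp
  have hexp : ∀ (k : ℕ) (x : ℝ), Real.exp (-x) * (p.coeff k * (s * x) ^ k) =
      (p.coeff k * s ^ k) * (Real.exp (-x) * x ^ k) := fun k x => by ring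
  have : momentMap (fun n => (n.factorial : ℝ) * s ^ n) p =
      ∫ x in Set.Ioi (0 : ℝ), Real.exp (-x) * p.eval (s * x) := by
    rw [momentMap_eq_sum _ p (Nat.lt_succ_self _)]
    simp_rw [Polynomial.eval_eq_sum_range, Finset.mul_sum, hexp]
    rw [integral_finsetSum _ fun k _ => (hint k).const_mul _]
    refine Finset.sum_congr rfl fun k _ => ?_
    rw [integral_const_mul, hval]
    ring
  rw [this]
  exact setIntegral_nonneg measurableSet_Ioi fun x hx =>
    mul_nonneg (Real.exp_pos _).le (hp _ (mul_nonneg hs (le_of_lt hx)))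

end Stieltjes

/-! ### Powers, substitutions and exponentials of power series -/

section Series

variable {A : Type*} [CommRing A]

theorem coeff_mul_pow_eq_zero {F : A⟦X⟧} (hF : constantCoeff F = 0) (G : A⟦X⟧) {n k : ℕ}
    (h : n < k) : coeff n (G * F ^ k) = 0 :=
  X_pow_dvd_iff.1 ((pow_dvd_pow_of_dvd (X_dvd_iff.2 hF) k).mul_left G) n h

theorem coeff_pow_eq_zero {F : A⟦X⟧} (hF : constantCoeff F = 0) {n k : ℕ} (h : n < k) :
    coeff n (F ^ k) = 0 := by
  simpa using coeff_mul_pow_eq_zero hF 1 h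

theorem coeff_subst_eq_sum {F : A⟦X⟧} (hF : constantCoeff F = 0) (h : A⟦X⟧) {n N : ℕ}
    (hN : n < N) : coeff n (h.subst F) = ∑ k ∈ Finset.range N, coeff k h * coeff n (F ^ k) := by
  rw [coeff_subst' (HasSubst.of_constantCoeff_zero' hF)]
  refine finsum_eq_sum_of_support_subset _ fun k hk => ?_
  simp only [Function.mem_support, smul_eq_mul] at hk
  simp only [Finset.coe_range, Set.mem_Iio]
  by_contra hcon
  exact hk (by rw [coeff_pow_eq_zero hF (by omega), mul_zero])

theorem constantCoeff_C_mul {F : A⟦X⟧} (hF : constantCoeff F = 0) (c : A) :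
    constantCoeff (C c * F) = 0 := by simp [hF]

theorem constantCoeff_map_eq_zero {B : Type*} [CommRing B] (φ : A →+* B) {F : A⟦X⟧}
    (hF : constantCoeff F = 0) : constantCoeff (PowerSeries.map φ F) = 0 := by
  rw [← coeff_zero_eq_constantCoeff_apply, coeff_map, coeff_zero_eq_constantCoeff_apply, hF,
    map_zero]

/-- Since `F' = ∑ Φ_i F^i`, multiplication by `F'` acts on the family `E F^k` through the Toeplitz
matrix of `Φ`. This is the source of all the production matrices. -/
theorem coeff_derivative_mul_pow {F Φ : A⟦X⟧} (hF : constantCoeff F = 0)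
    (hΦ : derivative A F = Φ.subst F) (E : A⟦X⟧) (n k : ℕ) :
    coeff n (derivative A F * (E * F ^ k)) =
      ∑ l ∈ Finset.range (n + 1), toeplitz Φ l k * coeff n (E * F ^ l) := by
  have h1 : coeff n (derivative A F * (E * F ^ k)) =
      ∑ i ∈ Finset.range (n + 1), coeff i Φ * coeff n (E * F ^ (k + i)) := by
    rw [coeff_mul]
    have h2 : ∀ x ∈ Finset.HasAntidiagonal.antidiagonal n, coeff x.1 (derivative A F) * coeff x.2 (E * F ^ k) =
        ∑ i ∈ Finset.range (n + 1), coeff i Φ * (coeff x.1 (F ^ i) * coeff x.2 (E * F ^ k)) := by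
      intro x hx
      rw [hΦ, coeff_subst_eq_sum hF Φ (N := n + 1) (by
        have := Finset.HasAntidiagonal.mem_antidiagonal.1 hx; omega), Finset.sum_mul]
      simp only [mul_assoc]
    rw [Finset.sum_congr rfl h2, Finset.sum_comm]
    refine Finset.sum_congr rfl fun i _ => ?_
    rw [← Finset.mul_sum, ← coeff_mul]
    congr 2
    ring
  -- The range is enlarged to contain every `l = k + i`; the added terms vanish because `F` has no
  -- constant term, and those with `l < k` vanish by triangularity.
  have h3 : ∑ l ∈ Finset.range (n + 1), toeplitz Φ l k * coeff n (E * F ^ l) =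
      ∑ l ∈ Finset.range (k + (n + 1)), toeplitz Φ l k * coeff n (E * F ^ l) := by
    refine Finset.sum_subset (by simp) fun l _ hl => ?_
    rw [coeff_mul_pow_eq_zero hF E (by simp at hl; omega), mul_zero]
  have h4 : ∑ l ∈ Finset.range k, toeplitz Φ l k * coeff n (E * F ^ l) = 0 :=
    Finset.sum_eq_zero fun l hl => by rw [toeplitz_of_lt Φ (by simpa using hl), zero_mul]
  rw [h1, h3, Finset.sum_range_add _ k (n + 1), h4, zero_add]
  refine Finset.sum_congr rfl fun i _ => ?_
  rw [toeplitz, if_pos (by omega), Nat.add_sub_cancel_left]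

variable [Algebra ℚ A]

/-- The inverse factorial in a `ℚ`-algebra. -/
noncomputable def invFact (A : Type*) [CommRing A] [Algebra ℚ A] (k : ℕ) : A :=
  algebraMap ℚ A (1 / k.factorial)

theorem factorial_mul_invFact (k : ℕ) : (k.factorial : A) * invFact A k = 1 := by
  rw [invFact, ← map_natCast (algebraMap ℚ A), ← map_mul,
    mul_one_div_cancel (by exact_mod_cast k.factorial_ne_zero), map_one]

theorem succ_mul_invFact (k : ℕ) : ((k + 1 : ℕ) : A) * invFact A (k + 1) = invFact A k := by
  have h1 := factorial_mul_invFact (A := A) (k + 1)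
  have h2 := factorial_mul_invFact (A := A) k
  rw [Nat.factorial_succ] at h1
  push_cast at h1 ⊢
  linear_combination (invFact A k) * h1 - ((k + 1) * invFact A (k + 1)) * h2

@[simp]
theorem invFact_zero : invFact A 0 = 1 := by simp [invFact]

theorem map_invFact {B : Type*} [CommRing B] [Algebra ℚ B] (φ : A →+* B) (k : ℕ) :
    φ (invFact A k) = invFact B k :=
  RingHom.congr_fun (Subsingleton.elim (φ.comp (algebraMap ℚ A)) (algebraMap ℚ B)) _

theorem coeff_expMul {F : A⟦X⟧} (hF : constantCoeff F = 0) (c : A) {n N : ℕ} (hN : n < N) :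
    coeff n (expMul c F) = ∑ k ∈ Finset.range N, invFact A k * c ^ k * coeff n (F ^ k) := by
  rw [expMul, coeff_subst_eq_sum (constantCoeff_C_mul hF c) _ hN]
  refine Finset.sum_congr rfl fun k _ => ?_
  rw [mul_pow, ← map_pow, coeff_C_mul, coeff_exp, invFact, mul_assoc]

theorem constantCoeff_expMul {F : A⟦X⟧} (hF : constantCoeff F = 0) (c : A) :
    constantCoeff (expMul c F) = 1 := by
  rw [← coeff_zero_eq_constantCoeff_apply, coeff_expMul hF c Nat.zero_lt_one]
  simp

theorem derivative_expMul {F : A⟦X⟧} (hF : constantCoeff F = 0) (c : A) :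
    derivative A (expMul c F) = C c * derivative A F * expMul c F := by
  rw [expMul, derivative_subst (HasSubst.of_constantCoeff_zero' (constantCoeff_C_mul hF c)),
    derivative_exp, Derivation.leibniz, derivative_C, smul_zero, add_zero, smul_eq_mul]
  ring

/-- Moving the scalar to the exponential makes `exp(c F)` and `exp(d F)` substitutions of the same
series, so the functional equation of `exp` transfers. -/
theorem expMul_eq_subst_rescale {F : A⟦X⟧} (hF : constantCoeff F = 0) (c : A) :
    expMul c F = (rescale c (exp A)).subst F := by
  ext n
  rw [expMul, coeff_subst_eq_sum (constantCoeff_C_mul hF c) _ (Nat.lt_succ_self n),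
    coeff_subst_eq_sum hF _ (Nat.lt_succ_self n)]
  refine Finset.sum_congr rfl fun k _ => ?_
  rw [mul_pow, ← map_pow, coeff_C_mul, coeff_rescale]
  ring

theorem expMul_mul_expMul {F : A⟦X⟧} (hF : constantCoeff F = 0) (c d : A) :
    expMul c F * expMul d F = expMul (c + d) F := by
  rw [expMul_eq_subst_rescale hF, expMul_eq_subst_rescale hF, expMul_eq_subst_rescale hF,
    ← subst_mul (HasSubst.of_constantCoeff_zero' hF), exp_mul_exp_eq_exp_add]

theorem expMul_zero {F : A⟦X⟧} : expMul 0 F = 1 := by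
  ext n
  rw [expMul, map_zero, zero_mul, ← zero_mul (0 : A⟦X⟧), ← map_zero (C (R := A)),
    coeff_subst_eq_sum (by simp) _ (Nat.lt_succ_self n), Finset.sum_eq_single 0]
  · simp
  · intro k _ hk
    simp [zero_pow hk]
  · simp

theorem map_expMul {B : Type*} [CommRing B] [Algebra ℚ B] (φ : A →+* B) {F : A⟦X⟧}
    (hF : constantCoeff F = 0) (c : A) :
    PowerSeries.map φ (expMul c F) = expMul (φ c) (PowerSeries.map φ F) := by
  ext n
  rw [coeff_map, coeff_expMul hF c (Nat.lt_succ_self n),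
    coeff_expMul (constantCoeff_map_eq_zero φ hF) (φ c) (Nat.lt_succ_self n), map_sum]
  refine Finset.sum_congr rfl fun k _ => ?_
  rw [map_mul, map_mul, map_pow, map_invFact, ← map_pow (PowerSeries.map φ), coeff_map]

/-- The coefficient of `q ^ k` in `S_n(f, g; q)`. -/
theorem sheffer_eq {f : A⟦X⟧} (hf : constantCoeff f = 0) (g : A⟦X⟧) (n k : ℕ) :
    sheffer f g n k = n.factorial * invFact A k * coeff n (g * f ^ k) := by
  have h1 : ∀ b, (coeff b (expMul (Polynomial.X : Polynomial A)
      (PowerSeries.map Polynomial.C f))).coeff k = invFact A k * coeff b (f ^ k) := by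
    intro b
    rw [coeff_expMul (constantCoeff_map_eq_zero _ hf) _ (Nat.lt_of_lt_of_le (Nat.lt_succ_self b)
      (Nat.le_add_right (b + 1) k)), Polynomial.finsetSum_coeff, Finset.sum_eq_single k]
    · rw [← map_pow, coeff_map, Polynomial.coeff_mul_C, ← map_invFact Polynomial.C,
        Polynomial.coeff_C_mul_X_pow, if_pos rfl]
    · intro j _ hj
      rw [← map_pow, coeff_map, Polynomial.coeff_mul_C, ← map_invFact Polynomial.C,
        Polynomial.coeff_C_mul_X_pow, if_neg (Ne.symm hj), zero_mul]
    · intro h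
      exact absurd (by simp) h
  rw [sheffer, shefferPoly, Polynomial.coeff_smul, coeff_mul, coeff_mul, Polynomial.finsetSum_coeff,
    nsmul_eq_mul, mul_assoc, Finset.mul_sum (Finset.HasAntidiagonal.antidiagonal n) _ (invFact A k)]
  congr 1
  refine Finset.sum_congr rfl fun x _ => ?_
  rw [coeff_map, Polynomial.coeff_C_mul, h1]
  ring

theorem shefferPoly_natDegree_lt {f : A⟦X⟧} (hf : constantCoeff f = 0) (g : A⟦X⟧) (n k : ℕ)
    (h : n < k) : sheffer f g n k = 0 := by
  rw [sheffer_eq hf, coeff_mul_pow_eq_zero hf g h, mul_zero]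

/-- `S_n(f, exp (λ f); q)` as a combination of the powers of `λ + q`. -/
theorem shefferPoly_expMul {f : A⟦X⟧} (hf : constantCoeff f = 0) (c : A) (n : ℕ) :
    shefferPoly f (expMul c f) n =
      n.factorial * coeff n (expMul (Polynomial.C c + Polynomial.X) (PowerSeries.map Polynomial.C f))
    := by
  rw [shefferPoly, map_expMul Polynomial.C hf, expMul_mul_expMul (constantCoeff_map_eq_zero _ hf), nsmul_eq_mul]

end Series

/-! ### Production matrices of exponential triangles -/

section Flow

variable {A : Type*} [CommRing A] [Algebra ℚ A]

/-- The matrix `[(j! / k!) Φ_{j-k}]`. -/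
noncomputable def factToeplitz (Φ : A⟦X⟧) (j k : ℕ) : A :=
  j.factorial * invFact A k * toeplitz Φ j k

theorem factToeplitz_of_lt (Φ : A⟦X⟧) {j k : ℕ} (h : j < k) : factToeplitz Φ j k = 0 := by
  rw [factToeplitz, toeplitz_of_lt Φ h, mul_zero]

/-- The triangle `[(n! / k!) [t^n] G(t) F(t)^k]`. -/
noncomputable def expTriangle (G F : A⟦X⟧) (n k : ℕ) : A :=
  n.factorial * invFact A k * coeff n (G * F ^ k)

theorem expTriangle_of_lt {F : A⟦X⟧} (hF : constantCoeff F = 0) (G : A⟦X⟧) {n k : ℕ} (h : n < k) :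
    expTriangle G F n k = 0 := by
  rw [expTriangle, coeff_mul_pow_eq_zero hF G h, mul_zero]

/-- The production matrix of `[(n! / k!) [t^n] exp (c F) F^k]`. -/
noncomputable def prodMatrix (c : A) (Φ : A⟦X⟧) (l k : ℕ) : A :=
  c * factToeplitz Φ l k + if k = 0 then 0 else factToeplitz Φ l (k - 1)

/-- The production matrix of `[(n! / k!) [t^n] F' exp (c F) F^k]`. -/
noncomputable def prodMatrix' (c : A) (Φ : A⟦X⟧) (l k : ℕ) : A :=
  c * factToeplitz Φ l k + factToeplitz Φ (l + 1) k

/-- Comes from `(E F^k)' = c F' E F^k + k F' E F^(k-1)`; the factor `k` is absorbed in `1/k!`, which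
shifts the second term to column `k - 1`. -/
theorem expTriangle_succ {F Φ E : A⟦X⟧} {c : A} (hF : constantCoeff F = 0)
    (hΦ : derivative A F = Φ.subst F) (hE : derivative A E = C c * derivative A F * E) (n k : ℕ) :
    expTriangle E F (n + 1) k =
      ∑ l ∈ Finset.range (n + 1), expTriangle E F n l * prodMatrix c Φ l k := by
  have h1 : expTriangle E F (n + 1) k =
      n.factorial * invFact A k * coeff n (derivative A (E * F ^ k)) := by
    rw [coeff_derivative, expTriangle, Nat.factorial_succ]
    push_cast
    ring
  have hl : ∀ l, expTriangle E F n l * (l.factorial : A) = n.factorial * coeff n (E * F ^ l) :=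
    fun l => by
      rw [expTriangle]
      linear_combination (n.factorial * coeff n (E * F ^ l)) * factorial_mul_invFact (A := A) l
  rw [h1]
  rcases k with _ | k
  · have h2 : derivative A (E * F ^ 0) = C c * (derivative A F * (E * F ^ 0)) := by
      rw [pow_zero, mul_one, hE, mul_assoc]
    rw [h2, coeff_C_mul, coeff_derivative_mul_pow hF hΦ, Finset.mul_sum, Finset.mul_sum]
    refine Finset.sum_congr rfl fun l _ => ?_
    simp only [prodMatrix, factToeplitz, if_true, add_zero]
    linear_combination -(c * invFact A 0 * toeplitz Φ l 0) * hl l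
  · have h2 : derivative A (E * F ^ (k + 1)) = C c * (derivative A F * (E * F ^ (k + 1))) +
        C ((k + 1 : ℕ) : A) * (derivative A F * (E * F ^ k)) := by
      rw [Derivation.leibniz, derivative_pow, hE, map_natCast, smul_eq_mul, smul_eq_mul,
        Nat.add_sub_cancel]
      ring
    rw [h2, map_add, coeff_C_mul, coeff_C_mul, coeff_derivative_mul_pow hF hΦ,
      coeff_derivative_mul_pow hF hΦ, Finset.mul_sum, Finset.mul_sum, ← Finset.sum_add_distrib,
      Finset.mul_sum]
    refine Finset.sum_congr rfl fun l _ => ?_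
    simp only [prodMatrix, factToeplitz, Nat.succ_ne_zero, if_false, Nat.add_sub_cancel]
    linear_combination -(c * invFact A (k + 1) * toeplitz Φ l (k + 1) +
      invFact A k * toeplitz Φ l k) * hl l + (n.factorial * toeplitz Φ l k * coeff n (E * F ^ l)) *
        succ_mul_invFact (A := A) k

theorem expTriangle_derivative_mul {F Φ : A⟦X⟧} (hF : constantCoeff F = 0)
    (hΦ : derivative A F = Φ.subst F) (E : A⟦X⟧) (n k : ℕ) :
    expTriangle (derivative A F * E) F n k =
      ∑ l ∈ Finset.range (n + 1), expTriangle E F n l * factToeplitz Φ l k := by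
  rw [expTriangle, mul_assoc (derivative A F), coeff_derivative_mul_pow hF hΦ, Finset.mul_sum]
  refine Finset.sum_congr rfl fun l _ => ?_
  rw [expTriangle, factToeplitz]
  linear_combination -(n.factorial * invFact A k * toeplitz Φ l k * coeff n (E * F ^ l)) *
    factorial_mul_invFact (A := A) l

/-- If `O` is the triangle of `E`, that of `F' E` is `O T`. Shifting the rows of `O T` up gives `O
(T (c I + Δ)) T = (O T) ((c I + Δ) T)`, so the two factors of the production matrix change order. -/
theorem expTriangle_derivative_mul_succ {F Φ E : A⟦X⟧} {c : A} (hF : constantCoeff F = 0)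
    (hΦ : derivative A F = Φ.subst F) (hE : derivative A E = C c * derivative A F * E) (n k : ℕ) :
    expTriangle (derivative A F * E) F (n + 1) k =
      ∑ l ∈ Finset.range (n + 1),
        expTriangle (derivative A F * E) F n l * prodMatrix' c Φ l k := by
  simp_rw [expTriangle_derivative_mul hF hΦ, expTriangle_succ hF hΦ hE, Finset.sum_mul]
  rw [Finset.sum_comm, Finset.sum_comm (s := Finset.range (n + 1)) (t := Finset.range (n + 1))]
  refine Finset.sum_congr rfl fun j hj => ?_
  simp only [prodMatrix, prodMatrix', mul_add, add_mul, mul_assoc, Finset.sum_add_distrib]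
  congr 1
  · rw [Finset.sum_range_succ _ (n + 1), factToeplitz_of_lt Φ (Finset.mem_range.1 hj), zero_mul,
      mul_zero, mul_zero, add_zero]
    exact Finset.sum_congr rfl fun l _ => by ring
  · rw [Finset.sum_range_succ' _ (n + 1)]
    simp

variable {D : Subsemiring A}

/-- The matrix is the product `T (c I + Δ)`. -/
theorem TP.prodMatrix {Φ : A⟦X⟧} (hT : TP D (factToeplitz Φ)) {c : A} (hc : c ∈ D) :
    TP D (prodMatrix c Φ) := by
  refine TP.mul hT (tp_upperBidiag hc) fun K => ⟨K + 1, fun i hi k hk => ?_⟩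
  have h1 : ∀ l, factToeplitz Φ i l * upperBidiag c l k =
      (if l = k then c * factToeplitz Φ i k else 0) +
        (if l + 1 = k then factToeplitz Φ i l else 0) := fun l => by
    rw [upperBidiag]
    split_ifs <;> first | omega | skip
    · subst_vars; ring
    all_goals simp
  simp_rw [h1, Finset.sum_add_distrib]
  rw [Finset.sum_ite_eq', if_pos (by simp; omega), ShefferTP.prodMatrix]
  congr 1
  rcases k with _ | k
  · simp
  · simp only [Nat.succ_ne_zero, if_false, Nat.add_right_cancel_iff]
    rw [Finset.sum_ite_eq', if_pos (by simp; omega), Nat.add_sub_cancel]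

/-- The matrix is the product `(c I + Δ) T`. -/
theorem TP.prodMatrix' {Φ : A⟦X⟧} (hT : TP D (factToeplitz Φ)) {c : A} (hc : c ∈ D) :
    TP D (prodMatrix' c Φ) := by
  refine TP.mul (tp_upperBidiag hc) hT fun K => ⟨K + 1, fun i hi k hk => ?_⟩
  have h1 : ∀ l, upperBidiag c i l * factToeplitz Φ l k =
      (if l = i then c * factToeplitz Φ i k else 0) +
        (if l = i + 1 then factToeplitz Φ (i + 1) k else 0) := fun l => by
    rw [upperBidiag]
    split_ifs <;> first | omega | skip
    · subst_vars; ring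
    · subst_vars; ring
    · ring
  simp_rw [h1, Finset.sum_add_distrib]
  rw [Finset.sum_ite_eq', Finset.sum_ite_eq', if_pos (by simp; omega), if_pos (by simp; omega),
    ShefferTP.prodMatrix']

theorem prodMatrix_of_lt (c : A) (Φ : A⟦X⟧) {i j : ℕ} (h : i + 1 < j) : prodMatrix c Φ i j = 0 := by
  rw [prodMatrix, factToeplitz_of_lt Φ (by omega), factToeplitz_of_lt Φ (by omega)]
  simp

theorem prodMatrix'_of_lt (c : A) (Φ : A⟦X⟧) {i j : ℕ} (h : i + 1 < j) :
    prodMatrix' c Φ i j = 0 := by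
  rw [prodMatrix', factToeplitz_of_lt Φ (by omega), factToeplitz_of_lt Φ (by omega)]
  simp

section

variable {F Φ E : A⟦X⟧} {c : A}

theorem TP.expTriangle (hT : TP D (factToeplitz Φ)) (hF : constantCoeff F = 0)
    (hΦ : derivative A F = Φ.subst F) (hc : c ∈ D) (hE0 : constantCoeff E = 1)
    (hE : derivative A E = C c * derivative A F * E) : TP D (expTriangle E F) := by
  refine TP.of_production (hT.prodMatrix hc) ?_
    (fun j => expTriangle_of_lt hF E (Nat.succ_pos j)) fun K => ⟨K + 1, fun i hi j hj => ?_⟩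
  · simp [ShefferTP.expTriangle, hE0, one_mem]
  · rw [expTriangle_succ hF hΦ hE]
    refine Finset.sum_subset (by simp; omega) fun l _ hl => ?_
    rw [expTriangle_of_lt hF E (by simp at hl; omega), zero_mul]

theorem TP.hankel_expTriangle (hT : TP D (factToeplitz Φ)) (hF : constantCoeff F = 0)
    (hΦ : derivative A F = Φ.subst F) (hc : c ∈ D) (hE0 : constantCoeff E = 1)
    (hE : derivative A E = C c * derivative A F * E) :
    TP D fun i j => ShefferTP.expTriangle E F (i + j) 0 := by
  refine TP.hankel_of_production (hT.prodMatrix hc) (fun i j => prodMatrix_of_lt c Φ) ?_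
    (fun i j => expTriangle_of_lt hF E) (expTriangle_succ hF hΦ hE)
  simp [ShefferTP.expTriangle, hE0, one_mem]

theorem TP.hankel_expTriangle_derivative (hT : TP D (factToeplitz Φ)) (hF : constantCoeff F = 0)
    (hΦ : derivative A F = Φ.subst F) (hc : c ∈ D) (hE0 : constantCoeff E = 1)
    (hE : derivative A E = C c * derivative A F * E) :
    TP D fun i j => ShefferTP.expTriangle (derivative A F * E) F (i + j) 0 := by
  refine TP.hankel_of_production (hT.prodMatrix' hc) (fun i j => prodMatrix'_of_lt c Φ) ?_
    (fun i j => expTriangle_of_lt hF _) (expTriangle_derivative_mul_succ hF hΦ hE)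
  rw [expTriangle_derivative_mul hF hΦ]
  simpa [ShefferTP.expTriangle, hE0] using hT.apply_mem 0 0

end

end Flow

/-! ### The series `f(w t) / w` -/

section Scale

variable {A : Type*} [CommRing A] [Algebra ℝ A]

/-- The series `f(w t) / w`. -/
noncomputable def scaleSeries (w : A) (f : ℝ⟦X⟧) : A⟦X⟧ :=
  mk fun n => w ^ (n - 1) * algebraMap ℝ A (coeff n f)

variable {f φ : ℝ⟦X⟧}

theorem constantCoeff_scaleSeries (hf : constantCoeff f = 0) (w : A) :
    constantCoeff (scaleSeries w f) = 0 := by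
  rw [← coeff_zero_eq_constantCoeff_apply, scaleSeries, coeff_mk,
    coeff_zero_eq_constantCoeff_apply, hf, map_zero, mul_zero]

theorem scaleSeries_one (f : ℝ⟦X⟧) :
    scaleSeries (1 : A) f = PowerSeries.map (algebraMap ℝ A) f := by
  ext n
  simp [scaleSeries]

/-- The truncated exponent `n - k` is harmless, since the coefficient vanishes for `n < k`; hence
`w` may be an indeterminate, with no division by it. -/
theorem coeff_scaleSeries_pow (hf : constantCoeff f = 0) (w : A) (n k : ℕ) :
    coeff n (scaleSeries w f ^ k) = w ^ (n - k) * algebraMap ℝ A (coeff n (f ^ k)) := by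
  induction k generalizing n with
  | zero =>
    rcases n with _ | n <;> simp [coeff_one]
  | succ k ih =>
    rw [pow_succ', coeff_mul, pow_succ', coeff_mul, map_sum, Finset.mul_sum]
    refine Finset.sum_congr rfl fun x hx => ?_
    have hx' := Finset.HasAntidiagonal.mem_antidiagonal.1 hx
    rw [ih, scaleSeries, coeff_mk, map_mul]
    rcases Nat.eq_zero_or_pos x.1 with h | h
    · rw [h, coeff_zero_eq_constantCoeff_apply, hf]
      simp
    rcases lt_or_ge x.2 k with h2 | h2
    · rw [coeff_pow_eq_zero hf h2]
      simp
    · rw [show n - (k + 1) = (x.1 - 1) + (x.2 - k) by omega, pow_add]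
      ring

/-- For `F(t) = f(w t)/w` the chain rule gives `F'(t) = φ(f(w t)) = φ(w F(t))`. -/
theorem derivative_scaleSeries (hf : constantCoeff f = 0) (hφ : derivative ℝ f = φ.subst f)
    (w : A) : derivative A (scaleSeries w f) =
      (rescale w (PowerSeries.map (algebraMap ℝ A) φ)).subst (scaleSeries w f) := by
  ext n
  rw [coeff_subst_eq_sum (constantCoeff_scaleSeries hf w) _ (Nat.lt_succ_self n)]
  have h1 := congrArg (fun g => algebraMap ℝ A (coeff n g)) hφ
  simp only [coeff_derivative, coeff_subst_eq_sum hf φ (Nat.lt_succ_self n), map_sum, map_mul,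
    map_add, map_natCast, map_one] at h1
  rw [coeff_derivative, scaleSeries, coeff_mk, Nat.add_sub_cancel, mul_assoc, h1, Finset.mul_sum]
  refine Finset.sum_congr rfl fun k hk => ?_
  rw [← scaleSeries, coeff_scaleSeries_pow hf, coeff_rescale, coeff_map]
  have hk' : k ≤ n := by simpa [Nat.lt_succ_iff] using hk
  rw [show w ^ n = w ^ k * w ^ (n - k) by rw [← pow_add, Nat.add_sub_cancel' hk']]
  ring

theorem TP.factToeplitz [Algebra ℚ A] {D : Subsemiring A}
    (hD : ∀ x : ℝ, 0 ≤ x → algebraMap ℝ A x ∈ D)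
    (hφ : TP (Subsemiring.nonneg ℝ) (toeplitz φ)) {w : A} (hw : w ∈ D) :
    TP D (factToeplitz (rescale w (PowerSeries.map (algebraMap ℝ A) φ))) := by
  have h1 := hφ.scale (u := fun i => (i.factorial : ℝ)) (v := fun k => invFact ℝ k)
    (fun i => Subsemiring.mem_nonneg.2 (Nat.cast_nonneg _))
    (fun i => Subsemiring.mem_nonneg.2 (by simp [invFact]))
  have h2 := (h1.map (algebraMap ℝ A) (D := D) hD).scale_pow_sub (fun i j hij => by
    rw [toeplitz_of_lt φ hij]; simp) hw
  convert h2 using 3 with i j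
  simp only [ShefferTP.factToeplitz, map_mul, map_natCast, map_invFact, toeplitz]
  split_ifs with h
  · rw [coeff_rescale, coeff_map]
    ring
  · simp

end Scale

/-! ### The sequences `∑ S_{n,k} c^k w^{n-k}` -/

section Sequences

variable {A : Type*} [CommRing A] [Algebra ℚ A]

theorem coeff_mul_expMul {F : A⟦X⟧} (hF : constantCoeff F = 0) (G : A⟦X⟧) (c : A) (n : ℕ) :
    coeff n (G * expMul c F) =
      ∑ k ∈ Finset.range (n + 1), invFact A k * c ^ k * coeff n (G * F ^ k) := by
  have h1 : ∀ x ∈ Finset.HasAntidiagonal.antidiagonal n, coeff x.1 G * coeff x.2 (expMul c F) =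
      ∑ k ∈ Finset.range (n + 1), invFact A k * c ^ k * (coeff x.1 G * coeff x.2 (F ^ k)) := by
    intro x hx
    rw [coeff_expMul hF c (N := n + 1) (by
      have := Finset.HasAntidiagonal.mem_antidiagonal.1 hx; omega), Finset.mul_sum]
    exact Finset.sum_congr rfl fun k _ => by ring
  rw [coeff_mul, Finset.sum_congr rfl h1, Finset.sum_comm]
  refine Finset.sum_congr rfl fun k _ => ?_
  rw [← Finset.mul_sum, coeff_mul]

theorem sheffer_one_eq {f : A⟦X⟧} (hf : constantCoeff f = 0) (n k : ℕ) :
    sheffer f 1 n k = n.factorial * invFact A k * coeff n (f ^ k) := by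
  rw [sheffer_eq hf, one_mul]

theorem map_sheffer {B : Type*} [CommRing B] [Algebra ℚ B] (ψ : A →+* B) {f : A⟦X⟧}
    (hf : constantCoeff f = 0) (n k : ℕ) :
    sheffer (PowerSeries.map ψ f) 1 n k = ψ (sheffer f 1 n k) := by
  rw [sheffer_one_eq hf, sheffer_one_eq (constantCoeff_map_eq_zero ψ hf), map_mul, map_mul,
    map_natCast, map_invFact, ← map_pow, coeff_map]

theorem shefferPoly_expMul_eq_sum {f : A⟦X⟧} (hf : constantCoeff f = 0) (c : A) (n : ℕ) :
    shefferPoly f (expMul c f) n = ∑ j ∈ Finset.range (n + 1),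
      Polynomial.C (sheffer f 1 n j) * (Polynomial.X + Polynomial.C c) ^ j := by
  rw [shefferPoly_expMul hf, coeff_expMul (constantCoeff_map_eq_zero _ hf) _ (Nat.lt_succ_self n),
    Finset.mul_sum]
  refine Finset.sum_congr rfl fun j _ => ?_
  rw [sheffer_one_eq hf, map_mul, map_mul, map_natCast, map_invFact, ← map_pow, coeff_map,
    add_comm (Polynomial.C c)]
  ring

/-- The homogenization of `S_n(f, exp (λ f); q)`. -/
theorem sum_sheffer_expMul {B : Type*} [CommRing B] (ψ : A →+* B) {f : A⟦X⟧}
    (hf : constantCoeff f = 0) (c : A) (s t : B) (n : ℕ) :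
    ∑ k ∈ Finset.range (n + 1), ψ (sheffer f (expMul c f) n k) * s ^ k * t ^ (n - k) =
      ∑ j ∈ Finset.range (n + 1), ψ (sheffer f 1 n j) * (s + ψ c * t) ^ j * t ^ (n - j) := by
  have h1 : ∀ k, ψ (sheffer f (expMul c f) n k) = ∑ j ∈ Finset.range (n + 1),
      ψ (sheffer f 1 n j) * (ψ c ^ (j - k) * (j.choose k : B)) := fun k => by
    rw [sheffer, shefferPoly_expMul_eq_sum hf, Polynomial.finsetSum_coeff, map_sum]
    refine Finset.sum_congr rfl fun j _ => ?_
    rw [Polynomial.coeff_C_mul, Polynomial.coeff_X_add_C_pow]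
    simp
  simp_rw [h1, Finset.sum_mul]
  rw [Finset.sum_comm]
  refine Finset.sum_congr rfl fun j hj => ?_
  have hj' : j ≤ n := by simpa [Nat.lt_succ_iff] using hj
  rw [add_pow, Finset.mul_sum, Finset.sum_mul]
  symm
  refine Finset.sum_subset_zero_on_sdiff (by simpa using hj') (fun k hk => ?_) fun k hk => ?_
  · rw [Nat.choose_eq_zero_of_lt (by simp at hk; omega)]
    simp
  · have hk' : k ≤ j := by simpa [Nat.lt_succ_iff] using hk
    rw [show n - k = (j - k) + (n - j) by omega, pow_add, mul_pow]
    ring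

theorem expTriangle_expMul_zero [Algebra ℝ A] {f : ℝ⟦X⟧} (hf : constantCoeff f = 0) (c w : A)
    (n : ℕ) :
    expTriangle (expMul c (scaleSeries w f)) (scaleSeries w f) n 0 =
      ∑ k ∈ Finset.range (n + 1), algebraMap ℝ A (sheffer f 1 n k) * c ^ k * w ^ (n - k) := by
  rw [expTriangle, pow_zero, mul_one, coeff_expMul (constantCoeff_scaleSeries hf w) c
    (Nat.lt_succ_self n), Finset.mul_sum]
  refine Finset.sum_congr rfl fun k _ => ?_
  rw [coeff_scaleSeries_pow hf, sheffer_one_eq hf, map_mul, map_mul, map_natCast, map_invFact,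
    invFact_zero]
  ring

theorem expTriangle_derivative_zero [Algebra ℝ A] {f : ℝ⟦X⟧} (hf : constantCoeff f = 0) (c w : A)
    (n : ℕ) :
    expTriangle (derivative A (scaleSeries w f) * expMul c (scaleSeries w f))
      (scaleSeries w f) n 0 = ∑ k ∈ Finset.range (n + 1),
        algebraMap ℝ A (sheffer f 1 (n + 1) (k + 1)) * c ^ k * w ^ (n - k) := by
  rw [expTriangle, pow_zero, mul_one, coeff_mul_expMul (constantCoeff_scaleSeries hf w),
    Finset.mul_sum]
  refine Finset.sum_congr rfl fun k _ => ?_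
  -- From `(F^(k+1))' = (k + 1) F^k F'`, which explains the shift of both indices.
  have h1 : ((k + 1 : ℕ) : A) * coeff n (derivative A (scaleSeries w f) * scaleSeries w f ^ k) =
      (n + 1) * (w ^ (n - k) * algebraMap ℝ A (coeff (n + 1) (f ^ (k + 1)))) := by
    have h2 := congrArg (coeff n) (derivative_pow (scaleSeries w f) (k + 1))
    rw [coeff_derivative, coeff_scaleSeries_pow hf, Nat.add_sub_cancel, Nat.add_sub_add_right,
      mul_assoc, ← map_natCast (C (R := A)), mul_assoc, coeff_C_mul] at h2
    rw [mul_comm (derivative A _), ← h2]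
    ring
  rw [sheffer_one_eq hf, map_mul (algebraMap ℝ A), map_mul (algebraMap ℝ A), map_natCast,
    map_invFact, invFact_zero, Nat.factorial_succ, ← succ_mul_invFact]
  push_cast at h1 ⊢
  linear_combination (n.factorial * invFact A (k + 1) * c ^ k) * h1

variable [Algebra ℝ A] {D : Subsemiring A} {f φ : ℝ⟦X⟧}

theorem TP.hankel_sheffer (hD : ∀ x : ℝ, 0 ≤ x → algebraMap ℝ A x ∈ D)
    (hf : constantCoeff f = 0) (hfφ : derivative ℝ f = φ.subst f)
    (hφ : TP (Subsemiring.nonneg ℝ) (toeplitz φ)) {c w : A} (hc : c ∈ D) (hw : w ∈ D) :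
    TP D fun i j => ∑ k ∈ Finset.range (i + j + 1),
      algebraMap ℝ A (sheffer f 1 (i + j) k) * c ^ k * w ^ (i + j - k) := by
  simp_rw [← expTriangle_expMul_zero hf]
  have hF := constantCoeff_scaleSeries hf w
  exact (hφ.factToeplitz hD hw).hankel_expTriangle hF (derivative_scaleSeries hf hfφ w) hc
    (constantCoeff_expMul hF c) (derivative_expMul hF c)

theorem TP.hankel_sheffer_succ (hD : ∀ x : ℝ, 0 ≤ x → algebraMap ℝ A x ∈ D)
    (hf : constantCoeff f = 0) (hfφ : derivative ℝ f = φ.subst f)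
    (hφ : TP (Subsemiring.nonneg ℝ) (toeplitz φ)) {c w : A} (hc : c ∈ D) (hw : w ∈ D) :
    TP D fun i j => ∑ k ∈ Finset.range (i + j + 1),
      algebraMap ℝ A (sheffer f 1 (i + j + 1) (k + 1)) * c ^ k * w ^ (i + j - k) := by
  simp_rw [← expTriangle_derivative_zero hf]
  have hF := constantCoeff_scaleSeries hf w
  exact (hφ.factToeplitz hD hw).hankel_expTriangle_derivative hF (derivative_scaleSeries hf hfφ w)
    hc (constantCoeff_expMul hF c) (derivative_expMul hF c)

theorem TP.sheffer_expMul (hD : ∀ x : ℝ, 0 ≤ x → algebraMap ℝ A x ∈ D)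
    (hf : constantCoeff f = 0) (hfφ : derivative ℝ f = φ.subst f)
    (hφ : TP (Subsemiring.nonneg ℝ) (toeplitz φ)) {c : A} (hc : c ∈ D) :
    TP D (sheffer (PowerSeries.map (algebraMap ℝ A) f)
      (expMul c (PowerSeries.map (algebraMap ℝ A) f))) := by
  have hF := constantCoeff_scaleSeries hf (1 : A)
  have h := (hφ.factToeplitz hD (one_mem D)).expTriangle hF (derivative_scaleSeries hf hfφ 1) hc
    (constantCoeff_expMul hF c) (derivative_expMul hF c)
  rw [scaleSeries_one] at h hF
  convert h using 1
  funext i j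
  rw [sheffer_eq hF, ShefferTP.expTriangle]

end Sequences

/-! ### Logarithmic, fractional and signed triangles -/

section Triangles

variable {f : ℝ⟦X⟧}

theorem fracTriangle_eq (hf : constantCoeff f = 0) (n k : ℕ) :
    fracTriangle f n k = k.factorial * sheffer f 1 n k := by
  set G := invOfUnit (1 - qMul f) 1 with hG
  have hc : constantCoeff (1 - qMul f) = 1 := by
    rw [qMul, map_sub, constantCoeff_C_mul (constantCoeff_map_eq_zero _ hf)]
    simp
  have h1 : G = 1 + qMul f * G := by
    have := mul_invOfUnit (1 - qMul f) 1 (by simpa using hc)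
    rw [← hG] at this
    linear_combination this
  have h2 : ∀ k n, (coeff n G).coeff k = coeff n (f ^ k) := by
    intro k
    induction k with
    | zero =>
      intro n
      rw [h1, qMul, mul_assoc, map_add, coeff_C_mul, Polynomial.coeff_add, Polynomial.coeff_X_mul_zero,
        add_zero, pow_zero, coeff_one, coeff_one]
      split_ifs <;> simp
    | succ k ih =>
      intro n
      rw [h1, qMul, mul_assoc, map_add, coeff_C_mul, Polynomial.coeff_add, Polynomial.coeff_X_mul,
        coeff_one, coeff_mul, Polynomial.finsetSum_coeff, pow_succ', coeff_mul]
      have : (if n = 0 then (1 : Polynomial ℝ) else 0).coeff (k + 1) = 0 := by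
        split_ifs <;> simp [Polynomial.coeff_one]
      rw [this, zero_add]
      refine Finset.sum_congr rfl fun x _ => ?_
      rw [coeff_map, Polynomial.coeff_C_mul, ih]
  rw [fracTriangle, fracPoly, Polynomial.coeff_smul, ← hG, h2, sheffer_one_eq hf, nsmul_eq_mul]
  linear_combination (-(n.factorial * coeff n (f ^ k))) * factorial_mul_invFact (A := ℝ) k

/-- The `q^k` term of `-log(1 - q f)` is `f^k / k`, and `k!/k = (k-1)!`. For `k = 0` the truncated
`k - 1` gives the factor 1, consistent with the convention for the zeroth column. -/
theorem logTriangle_eq (hf : constantCoeff f = 0) (n k : ℕ) :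
    logTriangle f n k = (k - 1).factorial * sheffer f 1 n k := by
  rw [logTriangle, logPoly, sheffer_one_eq hf]
  split_ifs with hn
  · subst hn
    rcases k with _ | k
    · simp
    · rw [coeff_pow_eq_zero hf (Nat.succ_pos k)]
      simp [Polynomial.coeff_one]
  · have hq : constantCoeff (-qMul f) = 0 := by
      rw [qMul, map_neg, constantCoeff_C_mul (constantCoeff_map_eq_zero _ hf), neg_zero]
    rw [coeff_subst_eq_sum hq _ (Nat.lt_of_lt_of_le (Nat.lt_succ_self n)
      (Nat.le_add_right (n + 1) k)), Polynomial.coeff_neg, Polynomial.coeff_smul,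
      Polynomial.finsetSum_coeff]
    have h1 : ∀ j, (coeff j (PowerSeries.log (Polynomial ℝ)) * coeff n ((-qMul f) ^ j)).coeff k =
        if k = j then (if j = 0 then 0 else -(1 / (j : ℝ)) * coeff n (f ^ j)) else 0 := by
      intro j
      have h2 : (-qMul f) ^ j =
          C ((-1) ^ j * Polynomial.X ^ j) * PowerSeries.map Polynomial.C (f ^ j) := by
        rw [qMul, neg_pow, mul_pow, map_mul, map_pow, map_pow, map_pow, map_neg, map_one]
        ring
      rw [h2, coeff_C_mul, coeff_map, coeff_log]
      by_cases hj : j = 0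
      · simp [hj]
      · rw [if_neg hj, if_neg hj]
        have h3 : algebraMap ℚ (Polynomial ℝ) ((-1) ^ (j + 1) / j) *
            ((-1) ^ j * Polynomial.X ^ j * Polynomial.C (coeff n (f ^ j))) =
            Polynomial.C (-(1 / (j : ℝ)) * coeff n (f ^ j)) * Polynomial.X ^ j := by
          have h4 : algebraMap ℚ (Polynomial ℝ) ((-1) ^ (j + 1) / j) =
              Polynomial.C ((-1) ^ (j + 1) / (j : ℝ)) := by
            rw [← RingHom.congr_fun (Subsingleton.elim
              ((Polynomial.C (R := ℝ)).comp (algebraMap ℚ ℝ)) (algebraMap ℚ (Polynomial ℝ)))]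
            simp
          rw [h4, show ((-1 : Polynomial ℝ)) ^ j = Polynomial.C ((-1) ^ j) by simp,
            show Polynomial.C ((-1) ^ (j + 1) / (j : ℝ)) * (Polynomial.C ((-1) ^ j) *
              Polynomial.X ^ j * Polynomial.C (coeff n (f ^ j))) =
              Polynomial.C (((-1) ^ (j + 1) / (j : ℝ)) * (-1) ^ j * coeff n (f ^ j)) *
                Polynomial.X ^ j by simp only [map_mul]; ring]
          congr 3
          rw [div_mul_eq_mul_div, ← pow_add, Odd.neg_one_pow ⟨j, by ring⟩]
          ring
        rw [h3, Polynomial.coeff_C_mul_X_pow]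
    simp_rw [h1]
    rw [Finset.sum_ite_eq, if_pos (by simp)]
    rcases k with _ | k
    · simp [coeff_one, hn]
    · rw [if_neg (Nat.succ_ne_zero k), Nat.add_sub_cancel, nsmul_eq_mul]
      have h5 := succ_mul_invFact (A := ℝ) k
      have h6 := factorial_mul_invFact (A := ℝ) k
      have h7 : (1 / ((k + 1 : ℕ) : ℝ)) = k.factorial * invFact ℝ (k + 1) := by
        rw [div_eq_iff (by positivity)]
        linear_combination -h6 - (k.factorial : ℝ) * h5
      rw [h7]
      ring

/-- Here the production runs along columns: `(f^(k+1))' = (k + 1) f' f^k` obtains column `k + 1`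
from column `k` through the Toeplitz matrix of `f'`, shifted by one. The signs split as `(-1)^(n+k)
= (-1)^(l+k) (-1)^(n-l)`. -/
theorem TP.signed_sheffer (hf : constantCoeff f = 0)
    (h : TP (Subsemiring.nonneg ℝ) fun i j => (-1) ^ (i - j) * toeplitz (derivative ℝ f) i j) :
    TP (Subsemiring.nonneg ℝ) (signed (sheffer f 1)) := by
  have h1 := h.scale (u := fun i => (i.factorial : ℝ)) (v := fun k => invFact ℝ k)
    (fun i => Subsemiring.mem_nonneg.2 (Nat.cast_nonneg _))
    (fun i => Subsemiring.mem_nonneg.2 (by simp [invFact]))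
  have h2 := h1.transpose.shift_col
  have h3 : TP (Subsemiring.nonneg ℝ) fun k n => signed (sheffer f 1) n k := by
    refine TP.of_production h2 ?_ ?_ fun K => ⟨K + 1, fun k hk n hn => ?_⟩
    · simp [signed, sheffer_one_eq hf]
    · intro n
      simp [signed, sheffer_one_eq hf, coeff_one]
    · rcases n with _ | n
      · simp [signed, sheffer_one_eq hf, coeff_pow_eq_zero hf]
      · simp only [Nat.succ_ne_zero, if_false, Nat.add_sub_cancel, signed, sheffer_one_eq hf]
        have h4 := congrArg (coeff n) (derivative_pow f (k + 1))
        have h5 : coeff n (derivative ℝ f * f ^ k) =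
            ∑ l ∈ Finset.range (K + 1), toeplitz (derivative ℝ f) n l * coeff l (f ^ k) := by
          rw [mul_comm, coeff_mul, Finset.Nat.sum_antidiagonal_eq_sum_range_succ_mk]
          refine Finset.sum_subset_zero_on_sdiff (by simp; omega) (fun l hl => ?_) fun l hl => ?_
          · rw [toeplitz_of_lt _ (by simp at hl; omega), zero_mul]
          · rw [toeplitz, if_pos (by simp at hl; omega), mul_comm]
        rw [coeff_derivative, Nat.add_sub_cancel, mul_assoc, ← map_natCast (C (R := ℝ)),
          coeff_C_mul, mul_comm (f ^ k), h5] at h4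
        have h6 : (-1 : ℝ) ^ (n + 1 + (k + 1)) * (((n + 1).factorial : ℝ) * invFact ℝ (k + 1) *
            coeff (n + 1) (f ^ (k + 1))) = (-1) ^ (n + k) * n.factorial * invFact ℝ (k + 1) *
              (coeff (n + 1) (f ^ (k + 1)) * (n + 1)) := by
          rw [Nat.factorial_succ]
          push_cast
          ring
        rw [h6, h4, Finset.mul_sum, Finset.mul_sum]
        refine Finset.sum_congr rfl fun l _ => ?_
        rcases lt_or_ge n l with h' | h'
        · simp [toeplitz_of_lt _ h']
        · have h7 : (-1 : ℝ) ^ (n + k) = (-1) ^ (l + k) * (-1) ^ (n - l) := by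
            rw [← pow_add]; congr 1; omega
          have h8 := succ_mul_invFact (A := ℝ) k
          have h9 := factorial_mul_invFact (A := ℝ) l
          rw [h7]
          set e1 : ℝ := (-1) ^ (l + k)
          set e2 : ℝ := (-1) ^ (n - l)
          linear_combination (e1 * e2 * n.factorial * toeplitz (derivative ℝ f) n l *
            coeff l (f ^ k)) * h8 - (e1 * e2 * n.factorial * invFact ℝ k *
              toeplitz (derivative ℝ f) n l * coeff l (f ^ k)) * h9
  exact h3.transpose

theorem signed_scale (M : ℕ → ℕ → ℝ) (v : ℕ → ℝ) :
    signed (fun n k => v k * M n k) = fun n k => 1 * signed M n k * v k := by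
  funext n k
  simp only [signed]
  ring

/-- The compositional inverse of `f` satisfies `f' = φ(f)` for `φ = 1 / f̄'`. -/
theorem derivative_eq_subst_of_inverse {g : ℝ⟦X⟧} (hf : constantCoeff f = 0)
    (hg : constantCoeff (derivative ℝ g) ≠ 0) (hgf : g.subst f = X) :
    derivative ℝ f = ((derivative ℝ g)⁻¹).subst f := by
  have hs : HasSubst f := HasSubst.of_constantCoeff_zero' hf
  have h1 : (derivative ℝ g).subst f * derivative ℝ f = 1 := by
    rw [← derivative_subst hs, hgf, derivative_X]
  have h2 : ((derivative ℝ g)⁻¹).subst f * (derivative ℝ g).subst f = 1 := by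
    rw [← subst_mul hs, PowerSeries.inv_mul_cancel _ hg, ← coe_substAlgHom hs, map_one]
  calc derivative ℝ f = (((derivative ℝ g)⁻¹).subst f * (derivative ℝ g).subst f) *
      derivative ℝ f := by rw [h2, one_mul]
    _ = _ := by rw [mul_assoc, h1, mul_one]

end Triangles

/-! ### Branched continued fractions -/

section Branched

variable {R : Type*} [CommRing R]

theorem dvd_prod_sub_prod {ι : Type*} (s : Finset ι) {d : R} {u v : ι → R}
    (h : ∀ i, d ∣ u i - v i) : d ∣ ∏ i ∈ s, u i - ∏ i ∈ s, v i := by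
  classical
  induction s using Finset.induction_on with
  | empty => simp
  | insert i s hi ih =>
    rw [Finset.prod_insert hi, Finset.prod_insert hi]
    have : u i * ∏ j ∈ s, u j - v i * ∏ j ∈ s, v j =
        u i * (∏ j ∈ s, u j - ∏ j ∈ s, v j) + (u i - v i) * ∏ j ∈ s, v j := by ring
    rw [this]
    exact dvd_add (ih.mul_left _) ((h i).mul_right _)

/-- The **Euler–Gauss recurrence method** for branched continued fractions. -/
theorem hasBranchedFraction_of_recurrence (m : ℕ) (a : ℕ → R) (g : ℕ → R⟦X⟧) (h0 : g 0 = 1)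
    (hc : ∀ k, constantCoeff (g k) = 1)
    (hg : ∀ k, g (k + 1) - g k = C (a k) * X * g (k + m + 1)) :
    HasBranchedFraction m a (g 1) := by
  set u : ℕ → R⟦X⟧ := fun k => invOfUnit (g k) 1 with hu
  have hgu : ∀ k, g k * u k = 1 := fun k => mul_invOfUnit _ _ (by simpa using hc k)
  -- The ratio `g_{k+1}/g_k` is the fraction started at level `k`: products of `m` consecutive
  -- ratios telescope, so the recurrence becomes the functional equation of the fraction.
  set F : ℕ → R⟦X⟧ := fun k => g (k + 1) * u k with hF
  have hFc : ∀ k, constantCoeff (F k) = 1 := fun k => by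
    simp [hF, hu, hc]
  have hprod : ∀ k n, ∏ i ∈ Finset.range n, F (k + (i + 1)) = g (k + n + 1) * u (k + 1) := by
    intro k n
    induction n with
    | zero => simp [hgu]
    | succ n ih =>
      rw [Finset.prod_range_succ, ih, hF]
      simp only
      rw [show k + (n + 1) = k + n + 1 by ring]
      linear_combination (g (k + n + 1 + 1) * u (k + 1)) * hgu (k + n + 1)
  have hF1 : ∀ k, F k * (1 - C (a k) * X * ∏ i : Fin m, F (k + (i + 1))) = 1 := by
    intro k
    have h1 := hprod k m
    rw [Finset.prod_range] at h1
    rw [h1, hF]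
    simp only
    linear_combination (u k) * hg k + hgu k -
      (C (a k) * X * g (k + m + 1) * u k) * hgu (k + 1)
  have hBD : ∀ N k, branchedConvergent m a (N + 1) k *
      (1 - C (a k) * X * ∏ i : Fin m, branchedConvergent m a N (k + (i + 1))) = 1 := by
    intro N k
    rw [branchedConvergent]
    exact invOfUnit_mul _ _ (by simp)
  -- Each level carries a factor `X`, so one more level improves the agreement by one order.
  have key : ∀ N k, X ^ (N + 1) ∣ branchedConvergent m a N k - F k := by
    intro N
    induction N with
    | zero =>
      intro k
      rw [zero_add, pow_one, X_dvd_iff]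
      simp [branchedConvergent, hFc]
    | succ N ih =>
      intro k
      have h1 : X ^ (N + 1) ∣ ∏ i : Fin m, branchedConvergent m a N (k + (i + 1)) -
          ∏ i : Fin m, F (k + (i + 1)) := dvd_prod_sub_prod _ fun i => ih _
      obtain ⟨e, he⟩ := h1
      refine ⟨branchedConvergent m a (N + 1) k * F k * C (a k) * e, ?_⟩
      linear_combination (branchedConvergent m a (N + 1) k * F k * C (a k) * X) * he +
        F k * hBD N k - branchedConvergent m a (N + 1) k * hF1 k
  have hF0 : F 0 = g 1 := by
    have := hgu 0
    rw [h0, one_mul] at this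
    simp [hF, this]
  intro n
  filter_upwards [Filter.eventually_ge_atTop n] with N hN
  have := X_pow_dvd_iff.1 (key N 0) n (by omega)
  rw [map_sub, sub_eq_zero, hF0] at this
  exact this

theorem derivative_scaleSeries_eq_prod [Algebra ℝ R] {m : ℕ} {f : ℝ⟦X⟧} (hf : constantCoeff f = 0)
    {x : Fin m → ℝ} (hfx : derivative ℝ f = (∏ i, (1 + C (x i) * X)).subst f) (w : R) :
    derivative R (scaleSeries w f) =
      ∏ i, (1 + C (w * algebraMap ℝ R (x i)) * scaleSeries w f) := by
  have hs : HasSubst (scaleSeries w f) :=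
    HasSubst.of_constantCoeff_zero' (constantCoeff_scaleSeries hf w)
  rw [derivative_scaleSeries hf hfx, ← coe_substAlgHom hs, map_prod, map_prod, map_prod]
  refine Finset.prod_congr rfl fun i _ => ?_
  have h1 : rescale w (PowerSeries.map (algebraMap ℝ R) (1 + C (x i) * X)) =
      1 + (w * algebraMap ℝ R (x i)) • X := by
    ext n
    rw [coeff_rescale, coeff_map, map_add, map_add, map_add, coeff_C_mul, coeff_smul, coeff_one,
      coeff_one, coeff_X, coeff_X]
    split_ifs with h2 h3 <;> simp_all
  rw [h1, map_add, map_one, map_smul, substAlgHom_X, smul_eq_C_mul]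

variable [Algebra ℚ R] {m : ℕ}

/-- The partial products `exp (c F) ∏_{l < i} (1 + y_l F)`. -/
noncomputable def partialProd (c : R) (y : Fin m → R) (F : R⟦X⟧) (i : ℕ) : R⟦X⟧ :=
  expMul c F * ∏ l ∈ Finset.range i, (1 + C (if h : l < m then y ⟨l, h⟩ else 0) * F)

/-- The series attached to the height `(m + 1) r + i`. -/
noncomputable def heightSeries (c : R) (y : Fin m → R) (F : R⟦X⟧) (r i : ℕ) : R⟦X⟧ :=
  mk fun n => expTriangle (partialProd c y F i) F (n + r) r

variable {c : R} {y : Fin m → R} {F : R⟦X⟧}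

theorem constantCoeff_partialProd (hF : constantCoeff F = 0) (i : ℕ) :
    constantCoeff (partialProd c y F i) = 1 := by
  simp [partialProd, constantCoeff_expMul hF, map_prod, hF]

theorem partialProd_eq (hF' : derivative R F = ∏ i, (1 + C (y i) * F)) :
    partialProd c y F m = expMul c F * derivative R F := by
  rw [partialProd, hF', Finset.prod_range]
  simp

theorem constantCoeff_heightSeries (hF : constantCoeff F = 0)
    (hF' : derivative R F = ∏ i, (1 + C (y i) * F)) (r i : ℕ) :
    constantCoeff (heightSeries c y F r i) = 1 := by
  -- Setting `t = 0` in the product formula gives `F'(0) = 1`, so `F = t G` with `G(0) = 1`.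
  obtain ⟨G, hG⟩ := X_dvd_iff.2 hF
  have hG1 : constantCoeff G = 1 := by
    have h1 := congrArg (coeff 0) hF'
    rw [coeff_derivative, zero_add, hG, coeff_succ_X_mul] at h1
    simpa [map_prod] using h1
  rw [← coeff_zero_eq_constantCoeff_apply, heightSeries, coeff_mk, zero_add, expTriangle,
    factorial_mul_invFact, one_mul]
  conv_lhs => rw [show F ^ r = X ^ r * G ^ r by rw [hG, mul_pow]]
  rw [mul_left_comm, coeff_X_pow_mul', if_pos le_rfl, Nat.sub_self,
    coeff_zero_eq_constantCoeff_apply, map_mul, constantCoeff_partialProd hF, map_pow, hG1]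
  simp

/-- The extra factor `1 + y_i F` raises `F^r` to `F^(r+1)`, and renormalizing `1/r!` to `1/(r+1)!`
produces the multiple `(r + 1) y_i`. -/
theorem heightSeries_succ (hF : constantCoeff F = 0) (r : ℕ) (i : Fin m) :
    heightSeries c y F r (i + 1) = heightSeries c y F r i +
      C (((r + 1 : ℕ) : R) * y i) * X * heightSeries c y F (r + 1) i := by
  have hP : partialProd c y F (i + 1) * F ^ r = partialProd c y F i * F ^ r +
      C (y i) * (partialProd c y F i * F ^ (r + 1)) := by
    rw [partialProd, Finset.prod_range_succ, dif_pos i.2, partialProd]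
    ring
  ext n
  rw [map_add, mul_assoc, coeff_C_mul, heightSeries, heightSeries, coeff_mk, coeff_mk, expTriangle,
    hP, map_add, coeff_C_mul, mul_add, ← expTriangle]
  congr 1
  rcases n with _ | n
  · rw [coeff_zero_X_mul, coeff_mul_pow_eq_zero hF _ (by omega)]
    simp
  · rw [coeff_succ_X_mul, heightSeries, coeff_mk, expTriangle,
      show n + (r + 1) = n + 1 + r by ring, ← succ_mul_invFact r]
    ring

theorem expTriangle_succ_expMul (hF : constantCoeff F = 0)
    (hF' : derivative R F = ∏ i, (1 + C (y i) * F)) (n r : ℕ) :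
    expTriangle (expMul c F) F (n + 1) r =
      c * expTriangle (partialProd c y F m) F n r +
        if r = 0 then 0 else expTriangle (partialProd c y F m) F n (r - 1) := by
  have h1 : expTriangle (expMul c F) F (n + 1) r =
      n.factorial * invFact R r * coeff n (derivative R (expMul c F * F ^ r)) := by
    rw [coeff_derivative, expTriangle, Nat.factorial_succ]
    push_cast
    ring
  rw [h1, partialProd_eq hF']
  rcases r with _ | r
  · have h2 : derivative R (expMul c F * F ^ 0) = C c * (expMul c F * derivative R F * F ^ 0) := by
      rw [pow_zero, mul_one, mul_one, derivative_expMul hF]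
      ring
    rw [h2, coeff_C_mul, if_pos rfl, expTriangle]
    ring
  · have h2 : derivative R (expMul c F * F ^ (r + 1)) =
        C c * (expMul c F * derivative R F * F ^ (r + 1)) +
          C ((r + 1 : ℕ) : R) * (expMul c F * derivative R F * F ^ r) := by
      rw [Derivation.leibniz, derivative_pow, derivative_expMul hF, map_natCast, smul_eq_mul,
        smul_eq_mul, Nat.add_sub_cancel]
      ring
    rw [h2, map_add, coeff_C_mul, coeff_C_mul, if_neg (Nat.succ_ne_zero r), Nat.add_sub_cancel,
      expTriangle, expTriangle, ← succ_mul_invFact r]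
    ring

/-- The step between blocks: the full product of the factors is `F'`, so differentiating `exp(c F)
F^(r+1)` leads back to the last series of block `r`. -/
theorem heightSeries_succ_zero (hF : constantCoeff F = 0)
    (hF' : derivative R F = ∏ i, (1 + C (y i) * F)) (r : ℕ) :
    heightSeries c y F (r + 1) 0 = heightSeries c y F r m +
      C c * X * heightSeries c y F (r + 1) m := by
  ext n
  rw [map_add, mul_assoc, coeff_C_mul, heightSeries, heightSeries, coeff_mk, coeff_mk, partialProd,
    Finset.prod_range_zero, mul_one, ← add_assoc, expTriangle_succ_expMul hF hF',
    if_neg (Nat.succ_ne_zero r), Nat.add_sub_cancel, add_comm]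
  congr 2
  rcases n with _ | n
  · rw [coeff_zero_X_mul, expTriangle_of_lt hF _ (by omega)]
  · rw [coeff_succ_X_mul, heightSeries, coeff_mk, show n + (r + 1) = n + 1 + r by ring]

theorem heightSeries_zero_zero (hF : constantCoeff F = 0)
    (hF' : derivative R F = ∏ i, (1 + C (y i) * F)) :
    heightSeries c y F 0 0 = 1 + C c * X * heightSeries c y F 0 m := by
  ext n
  rw [map_add, mul_assoc, coeff_C_mul, heightSeries, coeff_mk, partialProd,
    Finset.prod_range_zero, mul_one, add_zero]
  rcases n with _ | n
  · rw [coeff_zero_X_mul]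
    simp [expTriangle, constantCoeff_expMul hF]
  · rw [coeff_succ_X_mul, heightSeries, coeff_mk, expTriangle_succ_expMul hF hF', if_pos rfl,
      coeff_one, if_neg (Nat.succ_ne_zero n), add_zero, zero_add, add_zero]

theorem hasBranchedFraction_expMul (hF : constantCoeff F = 0)
    (hF' : derivative R F = ∏ i, (1 + C (y i) * F)) :
    HasBranchedFraction m (blockSeq c y) (mk fun n => expTriangle (expMul c F) F n 0) := by
  have h00 : heightSeries c y F 0 0 = mk fun n => expTriangle (expMul c F) F n 0 := by
    ext n
    simp [heightSeries, partialProd]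
  -- The heights are shifted by one so that `g 0 = 1` precedes the series of interest at `g 1`.
  set g : ℕ → R⟦X⟧ := fun k =>
    if k = 0 then 1 else heightSeries c y F ((k - 1) / (m + 1)) ((k - 1) % (m + 1)) with hg
  have hg1 : heightSeries c y F 0 0 = g 1 := by simp [hg]
  rw [← h00, hg1]
  refine hasBranchedFraction_of_recurrence m _ g (if_pos rfl) (fun k => ?_) fun k => ?_ <;>
    simp only [hg]
  · split_ifs
    · simp
    · exact constantCoeff_heightSeries hF hF' _ _
  · have hpos : 0 < m + 1 := Nat.succ_pos m
    have hdiv : ∀ r i, i < m + 1 → ((m + 1) * r + i) / (m + 1) = r ∧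
        ((m + 1) * r + i) % (m + 1) = i := fun r i hi => by
      rw [Nat.mul_add_div hpos, Nat.div_eq_of_lt hi, Nat.mul_add_mod, Nat.mod_eq_of_lt hi]
      simp
    simp only [Nat.succ_ne_zero, if_false, Nat.add_sub_cancel]
    obtain ⟨r, i, hi, rfl⟩ : ∃ r i, i < m + 1 ∧ k = (m + 1) * r + i :=
      ⟨k / (m + 1), k % (m + 1), Nat.mod_lt _ hpos, (Nat.div_add_mod _ _).symm⟩
    rcases i with _ | i
    · have hb : blockSeq c y ((m + 1) * r + 0) = c := by
        rw [blockSeq, dif_pos (by rw [(hdiv r 0 hi).2])]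
      rw [hb, (hdiv r 0 hi).1, (hdiv r 0 hi).2, add_zero, (hdiv r m (Nat.lt_succ_self m)).1,
        (hdiv r m (Nat.lt_succ_self m)).2]
      rcases r with _ | r
      · rw [if_pos (by simp), heightSeries_zero_zero hF hF']
        ring
      · have e : (m + 1) * (r + 1) - 1 = (m + 1) * r + m := by
          rw [Nat.mul_succ]; omega
        rw [if_neg (by simp), e, (hdiv r m (Nat.lt_succ_self m)).1,
          (hdiv r m (Nat.lt_succ_self m)).2, heightSeries_succ_zero hF hF']
        ring
    · have hi' : i < m := by omega
      have hb : blockSeq c y ((m + 1) * r + (i + 1)) = ((r + 1 : ℕ) : R) * y ⟨i, hi'⟩ := by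
        rw [blockSeq, dif_neg (by rw [(hdiv r (i + 1) hi).2]; omega)]
        simp only [(hdiv r (i + 1) hi).1, (hdiv r (i + 1) hi).2, Nat.add_sub_cancel]
      have e1 : (m + 1) * r + (i + 1) - 1 = (m + 1) * r + i := by omega
      have e2 : (m + 1) * r + (i + 1) + m = (m + 1) * (r + 1) + i := by ring
      rw [hb, if_neg (by omega), e1, e2, (hdiv r (i + 1) hi).1, (hdiv r (i + 1) hi).2,
        (hdiv r i (by omega)).1, (hdiv r i (by omega)).2, (hdiv (r + 1) i (by omega)).1,
        (hdiv (r + 1) i (by omega)).2]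
      have := heightSeries_succ (c := c) (y := y) hF r ⟨i, hi'⟩
      simp only at this
      rw [this]
      ring

end Branched

/-! ### Polynomials with nonnegative coefficients -/

section Main

/-- The polynomials whose coefficients belong to a given subsemiring. -/
def coeffSubsemiring {A : Type*} [CommRing A] (D : Subsemiring A) :
    Subsemiring (Polynomial A) where
  carrier := {p | ∀ i, p.coeff i ∈ D}
  mul_mem' hp hq i := by
    rw [Polynomial.coeff_mul]
    exact sum_mem fun x _ => mul_mem (hp _) (hq _)
  one_mem' i := by
    rw [Polynomial.coeff_one]
    split_ifs
    exacts [one_mem D, zero_mem D]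
  add_mem' hp hq i := by
    rw [Polynomial.coeff_add]
    exact add_mem (hp i) (hq i)
  zero_mem' i := by
    rw [Polynomial.coeff_zero]
    exact zero_mem D

theorem C_mem_coeffSubsemiring {A : Type*} [CommRing A] {D : Subsemiring A} {a : A} (ha : a ∈ D) :
    Polynomial.C a ∈ coeffSubsemiring D := fun i => by
  rw [Polynomial.coeff_C]
  split_ifs
  exacts [ha, zero_mem D]

theorem X_mem_coeffSubsemiring {A : Type*} [CommRing A] {D : Subsemiring A} :
    Polynomial.X ∈ coeffSubsemiring D := fun i => by
  rw [Polynomial.coeff_X]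
  split_ifs
  exacts [one_mem D, zero_mem D]

theorem reflect_eq_sum {A : Type*} [CommRing A] {p : Polynomial A} {n : ℕ}
    (h : ∀ k, n < k → p.coeff k = 0) : Polynomial.reflect n p =
      ∑ k ∈ Finset.range (n + 1), Polynomial.C (p.coeff k) * Polynomial.X ^ (n - k) := by
  ext i
  rw [Polynomial.coeff_reflect, Polynomial.finsetSum_coeff]
  simp_rw [Polynomial.coeff_C_mul_X_pow]
  rcases le_or_gt i n with hi | hi
  · rw [Polynomial.revAt_le hi, Finset.sum_eq_single (n - i)]
    · rw [if_pos (by omega)]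
    · intro k hk hki
      rw [if_neg (by simp at hk; omega)]
    · intro hk
      exact absurd (by simp) hk
  · rw [Polynomial.revAt_eq_self_of_lt hi, h i hi]
    refine (Finset.sum_eq_zero fun k _ => ?_).symm
    rw [if_neg (by omega)]

variable {f : ℝ⟦X⟧}

theorem shefferExp_eq (hf : constantCoeff f = 0) (n : ℕ) :
    shefferExp f n = ∑ k ∈ Finset.range (n + 1),
      algebraMap ℝ (Polynomial (Polynomial ℝ)) (sheffer f 1 n k) *
        (Polynomial.C Polynomial.X + Polynomial.X) ^ k * 1 ^ (n - k) := by
  have hF : constantCoeff (liftSeries f) = 0 := constantCoeff_map_eq_zero _ hf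
  rw [shefferExp, expLam, shefferPoly_expMul_eq_sum hF]
  refine Finset.sum_congr rfl fun k _ => ?_
  rw [liftSeries, map_sheffer Polynomial.C hf, one_pow, mul_one, add_comm Polynomial.X]
  rfl

theorem shefferExpStar_eq (hf : constantCoeff f = 0) (n : ℕ) :
    shefferExpStar f n = ∑ k ∈ Finset.range (n + 1),
      algebraMap ℝ (Polynomial (Polynomial ℝ)) (sheffer f 1 n k) *
        (Polynomial.X * Polynomial.C Polynomial.X + 1) ^ k * Polynomial.X ^ (n - k) := by
  have hF : constantCoeff (liftSeries f) = 0 := constantCoeff_map_eq_zero _ hf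
  rw [shefferExpStar, shefferExp, expLam,
    reflect_eq_sum fun k hk => shefferPoly_natDegree_lt hF _ n k hk]
  have := sum_sheffer_expMul (Polynomial.C (R := Polynomial ℝ)) hF Polynomial.X 1 Polynomial.X n
  simp only [one_pow, mul_one] at this
  refine this.trans (Finset.sum_congr rfl fun k _ => ?_)
  rw [liftSeries, map_sheffer Polynomial.C hf, add_comm 1, mul_comm Polynomial.X]
  rfl

end Main

end ShefferTP

/-! ### Assembly of the six assertions -/

open ShefferTP

theorem mainTheorem6 (f : PowerSeries ℝ)
    (hf0 : PowerSeries.constantCoeff f = 0)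
    (hf1 : PowerSeries.coeff 1 f ≠ 0)
    -- `1 / f̄'(t)` is a PF function, `f̄` being the compositional inverse of `f`
    (hPF : ShefferTP.IsPF
      (PowerSeries.derivative ℝ (f.substInvOfIsUnit hf1.isUnit))⁻¹) :
    -- (i)
    (ShefferTP.IsPolySM₂ (ShefferTP.shefferExp f) ∧
      ShefferTP.IsLogConvexOfOrder ShefferTP.NonnegCoeff₂ 3 (ShefferTP.shefferExp f) ∧
      ShefferTP.IsPolySM₂ (ShefferTP.shefferExpStar f) ∧
      ShefferTP.IsLogConvexOfOrder ShefferTP.NonnegCoeff₂ 3 (ShefferTP.shefferExpStar f)) ∧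
    -- (ii)
    (ShefferTP.IsSM (fun n => ShefferTP.egfCoeff f (n + 1)) ∧
      ShefferTP.IsLogConvexOfOrder (fun x : ℝ => 0 ≤ x) 3
        (fun n => ShefferTP.egfCoeff f (n + 1))) ∧
    -- (iii)
    ShefferTP.IsPolyTP
      (ShefferTP.sheffer (ShefferTP.liftSeries f) (ShefferTP.expLam f)) ∧
    -- (iv)
    (ShefferTP.IsTP (ShefferTP.logTriangle f) ∧
      ShefferTP.IsTP (ShefferTP.fracTriangle f) ∧
      ShefferTP.IsTP
        (ShefferTP.signed (ShefferTP.sheffer (f.substInvOfIsUnit hf1.isUnit) 1)) ∧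
      ShefferTP.IsTP
        (ShefferTP.signed (ShefferTP.logTriangle (f.substInvOfIsUnit hf1.isUnit))) ∧
      ShefferTP.IsTP
        (ShefferTP.signed (ShefferTP.fracTriangle (f.substInvOfIsUnit hf1.isUnit)))) ∧
    -- (v)
    ((∀ lam : ℝ, 0 ≤ lam → ShefferTP.ConvolutionPreservesSM
        (ShefferTP.sheffer f (ShefferTP.expMul lam f))) ∧
      ShefferTP.ConvolutionPreservesSM (fun n k => ShefferTP.sheffer f 1 (n + 1) (k + 1)) ∧
      ShefferTP.ConvolutionPreservesSM (ShefferTP.fracTriangle f)) ∧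
    -- (vi), where `Polynomial.C Polynomial.X` is `λ` and `Polynomial.X` is `q`
    (∀ (m : ℕ) (x : Fin m → ℝ),
      (PowerSeries.derivative ℝ (f.substInvOfIsUnit hf1.isUnit))⁻¹
          = ∏ i, (1 + PowerSeries.C (x i) * PowerSeries.X) →
      ShefferTP.HasBranchedFraction m
          (ShefferTP.blockSeq
            (Polynomial.C Polynomial.X + Polynomial.X)
            (fun i => Polynomial.C (Polynomial.C (x i))))
          (PowerSeries.mk (ShefferTP.shefferExp f)) ∧
      ShefferTP.HasBranchedFraction m
          (ShefferTP.blockSeq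
            (Polynomial.X * Polynomial.C Polynomial.X + 1)
            (fun i => Polynomial.X * Polynomial.C (Polynomial.C (x i))))
          (PowerSeries.mk (ShefferTP.shefferExpStar f))) := by
  set g := f.substInvOfIsUnit hf1.isUnit with hg
  set φ := (PowerSeries.derivative ℝ g)⁻¹ with hφ
  have hg0 : constantCoeff g = 0 := constantCoeff_substInvOfIsUnit f hf1.isUnit
  have hg' : constantCoeff (derivative ℝ g) ≠ 0 := by
    rw [← coeff_zero_eq_constantCoeff_apply, coeff_derivative, zero_add, hg,
      coeff_one_substInvOfIsUnit]
    simpa using hf1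
  have hfφ : derivative ℝ f = φ.subst f := derivative_eq_subst_of_inverse hf0 hg'
    (subst_substInvOfIsUnit_left f hf0 hf1.isUnit)
  have hTP : TP (Subsemiring.nonneg ℝ) (toeplitz φ) := fun k r c hr hc => hPF k r c hr hc
  have hinv := hTP.toeplitz_inverse (PowerSeries.inv_mul_cancel _ hg')
  have hD0 : ∀ x : ℝ, 0 ≤ x → algebraMap ℝ ℝ x ∈ Subsemiring.nonneg ℝ := fun x hx => hx
  have hD1 : ∀ x : ℝ, 0 ≤ x →
      algebraMap ℝ (Polynomial ℝ) x ∈ coeffSubsemiring (Subsemiring.nonneg ℝ) :=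
    fun x hx => C_mem_coeffSubsemiring (hD0 x hx)
  have hD2 : ∀ x : ℝ, 0 ≤ x → algebraMap ℝ (Polynomial (Polynomial ℝ)) x ∈
      coeffSubsemiring (coeffSubsemiring (Subsemiring.nonneg ℝ)) :=
    fun x hx => C_mem_coeffSubsemiring (hD1 x hx)
  have hlam : (Polynomial.C Polynomial.X : Polynomial (Polynomial ℝ)) ∈
      coeffSubsemiring (coeffSubsemiring (Subsemiring.nonneg ℝ)) :=
    C_mem_coeffSubsemiring X_mem_coeffSubsemiring
  have hS : TP (coeffSubsemiring (coeffSubsemiring (Subsemiring.nonneg ℝ)))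
      fun i j => shefferExp f (i + j) := by
    simp_rw [shefferExp_eq hf0]
    exact TP.hankel_sheffer hD2 hf0 hfφ hTP (add_mem hlam X_mem_coeffSubsemiring) (one_mem _)
  have hS' : TP (coeffSubsemiring (coeffSubsemiring (Subsemiring.nonneg ℝ)))
      fun i j => shefferExpStar f (i + j) := by
    simp_rw [shefferExpStar_eq hf0]
    exact TP.hankel_sheffer hD2 hf0 hfφ hTP
      (add_mem (mul_mem X_mem_coeffSubsemiring hlam) (one_mem _)) X_mem_coeffSubsemiring
  have hE : TP (Subsemiring.nonneg ℝ) fun i j => egfCoeff f (i + j + 1) := by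
    -- With `c = 0` and `w = 1` only `k = 0` survives, leaving `S_{n+1,1}(f,1) = f_{n+1}`.
    have := TP.hankel_sheffer_succ hD0 hf0 hfφ hTP (zero_mem _) (one_mem _)
    convert this using 3 with i j
    rw [Finset.sum_eq_single 0]
    · rw [sheffer_one_eq hf0, egfCoeff, ← succ_mul_invFact]
      simp [invFact]
    · intro k _ hk
      simp [zero_pow hk]
    · simp
  have hS1 : TP (Subsemiring.nonneg ℝ) (sheffer f 1) := by
    have := TP.sheffer_expMul hD0 hf0 hfφ hTP (zero_mem _)
    rwa [expMul_zero, show PowerSeries.map (algebraMap ℝ ℝ) f = f by ext; simp] at this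
  have hconv : ∀ lam : ℝ, 0 ≤ lam → ConvolutionPreservesSM (sheffer f (expMul lam f)) :=
    fun lam hl => convolutionPreservesSM_of_isSM fun s t hs ht => by
      have h1 := sum_sheffer_expMul (RingHom.id ℝ) hf0 lam s t
      simp only [RingHom.id_apply] at h1
      simp_rw [h1]
      -- For geometric inputs, the factor `exp(λ f)` merely replaces `s` by `s + λ t`.
      exact (TP.hankel_sheffer hD0 hf0 hfφ hTP (c := s + lam * t) (w := t)
        (add_nonneg hs (mul_nonneg hl ht)) ht).isSM
  have hfac : ∀ k : ℕ, (k.factorial : ℝ) ∈ Subsemiring.nonneg ℝ := fun k =>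
    Subsemiring.mem_nonneg.2 (Nat.cast_nonneg _)
  have h1m : ∀ _ : ℕ, (1 : ℝ) ∈ Subsemiring.nonneg ℝ := fun _ => one_mem _
  have hsg := TP.signed_sheffer hg0 hinv
  have hlog : ∀ {h : ℝ⟦X⟧}, constantCoeff h = 0 →
      logTriangle h = fun n k => ((k - 1).factorial : ℝ) * sheffer h 1 n k := fun hh => by
    funext n k; exact logTriangle_eq hh n k
  have hfrac : ∀ {h : ℝ⟦X⟧}, constantCoeff h = 0 →
      fracTriangle h = fun n k => (k.factorial : ℝ) * sheffer h 1 n k := fun hh => by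
    funext n k; exact fracTriangle_eq hh n k
  have hE_SM : IsSM fun n => egfCoeff f (n + 1) := hE.isSM
  have hE_log : IsLogConvexOfOrder (· ∈ Subsemiring.nonneg ℝ) 3 fun n => egfCoeff f (n + 1) :=
    isLogConvexOfOrder_three hE
  refine ⟨⟨hS, isLogConvexOfOrder_three hS, hS', isLogConvexOfOrder_three hS'⟩,
    ⟨hE_SM, hE_log⟩, ?_, ⟨?_, ?_, hsg, ?_, ?_⟩, ⟨hconv, ?_, ?_⟩, ?_⟩
  · exact TP.sheffer_expMul hD1 hf0 hfφ hTP X_mem_coeffSubsemiring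
  · have := hS1.scale h1m fun k => hfac (k - 1)
    rw [hlog hf0]
    simp only [one_mul, mul_comm] at this ⊢
    exact this
  · have := hS1.scale h1m hfac
    rw [hfrac hf0]
    simp only [one_mul, mul_comm] at this ⊢
    exact this
  · rw [hlog hg0, signed_scale _ fun k => ((k - 1).factorial : ℝ)]
    exact hsg.scale h1m fun k => hfac (k - 1)
  · rw [hfrac hg0, signed_scale]
    exact hsg.scale h1m hfac
  · exact convolutionPreservesSM_of_isSM fun s t hs ht =>
      (TP.hankel_sheffer_succ hD0 hf0 hfφ hTP (c := s) (w := t) hs ht).isSM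
  · refine convolutionPreservesSM_of_isSM fun s t hs ht => ?_
    -- The factor `k!` of the fractional triangle is absorbed into the first sequence, so the case
    -- `λ = 0` applies.
    have h1 := hconv 0 le_rfl _ _ (IsSM.factorial_mul_pow hs) (IsSM.pow ht)
    rw [expMul_zero] at h1
    convert h1 using 4 with n k
    rw [hfrac hf0]
    ring
  · intro m x hx
    have hfx : derivative ℝ f = (∏ i, (1 + C (x i) * X)).subst f := by rw [← hx]; exact hfφ
    -- The pair `w = 1`, `c = λ + q` gives the coefficients `α`, and `w = q`, `c = qλ + 1` gives
    -- `β`, because the roots enter as `w x_i`.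
    have key := fun w c => hasBranchedFraction_expMul (c := c)
      (constantCoeff_scaleSeries (A := Polynomial (Polynomial ℝ)) hf0 w)
      (derivative_scaleSeries_eq_prod hf0 hfx w)
    simp_rw [expTriangle_expMul_zero hf0] at key
    constructor
    · have := key 1 (Polynomial.C Polynomial.X + Polynomial.X)
      simp_rw [← shefferExp_eq hf0, one_mul] at this
      exact this
    · have := key Polynomial.X (Polynomial.X * Polynomial.C Polynomial.X + 1)
      simp_rw [← shefferExpStar_eq hf0] at this
      exact this
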